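/- **Conventions.** For closed subschemes $Y_1=V(\mathcal M_1)$, $Y_2=V(\mathcal M_2)$ of a scheme $X$ put $Y_1+Y_2=V(\mathcal M_1\mathcal M_2)$, $Y_1\cap Y_2=V(\mathcal M_1+\mathcal M_2)$, $Y_1\cup Y_2=V(\mathcal M_1\cap\mathcal M_2)$, and write $nY$ for the $n$-fold sum (arbitrary intersections correspond to sums of ideals; an empty intersection is $X$, an empty sum is $\emptyset$). A closed subscheme is locally principal (resp. a Cartier divisor) if its ideal is locally generated by one element (resp. by one non-zero-divisor). Given finitely many pairs $[Y_i,D_i]$ of closed subschemes of $X$ with every $D_i$ locally principal, the dilatation $\mathrm{Bl}\{^{D_i}_{Y_i}\}_{i}X$ is the $X$-affine scheme which, over an affine open $\mathrm{Spec}\,A\subset X$ on which $Y_i=V(M_i)$ and $D_i=V(a_i)$, is the spectrum of the $A$-subalgebra of $A[a_i^{-1}\mid i]$ generated by all fractions $m/a_i$ with $m\in M_i$. For a finite totally ordered set $J$, closed subschemes $(Y_j)_{j\in J}$ of $Y$ with $Y_{j'}\subset Y_j$ for $j\le j'$, and locally principal closed subschemes $(D_j)_{j\in J}$ of $Y$,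 put $$\mathbb D\big(({}^{D_j}_{Y_j})_{j\in J}\,{}_{Y}\big)=\mathrm{Bl}\Big\{{}^{\sum_{j'\ge j}D_{j'}}_{Y_j}\Big\}_{j\in J}Y .$$ If $Y$ is an $X$-scheme and the $D_j$ are closed subschemes of $X$, the same notation is used with $D_j$ replaced by its pullback to $Y$. **Setting.** Let $I$ be a finite totally ordered set, $X$ a scheme, $(X_i)_{i\in I}$ closed subschemes of $X$ with $X_{i'}\subset X_i$ for $i\le i'$, and $(D_i)_{i\in I}$ locally principal closed subschemes of $X$ such that $X_i\cap D_j$ is a Cartier divisor in $X_i$ for all $i,j\in I$. Let $S\subset I$, $K=I\setminus S$, and $S_{>k}=\{s\in S\mid s>k\}$. Put $\mathbb D_S=\mathbb D\big(({}^{D_s}_{X_s})_{s\in S}\,{}_{X}\big)$. **Statement.** Assume that $S>K$ (that is, $s>k$ for all $s\in S$, $k\in K$) and that for all $k\in K$ with $S_{>k}\neq\emptyset$ the following hold. (a) For every nonzero $\theta\in\mathbb N^{S_{>k}}$, with $s'=\min\{s\in S_{>k}\mid\theta_s>0\}$, $$\Big(\sum_{s\in S_{>k}}\theta_sX_s\Big)\cup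 X_k=\Big(\sum_{s\in S_{>s'}}\theta_sX_s\Big)+(\theta_{s'}-1)X_{s'}+X_k .$$ (b) For every set $E$ and all families $\theta^{(e)}\in\mathbb N^{S_{>k}}$, $\gamma^{(e)}\in\mathbb N^{S}$ $(e\in E)$, $$\Big(\bigcap_{e\in E}\Big(\sum_{s\in S}\gamma^{(e)}_sD_s+\sum_{s\in S_{>k}}\theta^{(e)}_sX_s\Big)\Big)\cup X_k=\bigcap_{e\in E}\Big(\sum_{s\in S}\gamma^{(e)}_sD_s+\Big(\Big(\sum_{s\in S_{>k}}\theta^{(e)}_sX_s\Big)\cup X_k\Big)\Big).$$ Then: (1) For every $k\in K$ there is a unique $X$-morphism $F_k:\mathbb D\big(({}^{D_s}_{X_s\cap X_k})_{s\in S}\,{}_{X_k}\big)\to\mathbb D_S$, and it is a closed immersion; the resulting closed subschemes of $\mathbb D_S$ decrease as $k$ increases. With the sources of the $F_k$ regarded as closed subschemes of $\mathbb D_S$, there is a unique $X$-morphism $$\Theta(S):\ \mathbb D\Big(\Big({}^{D_k}_{\mathbb D(({}^{D_s}_{X_s\cap X_k})_{s\in S}\,{}_{X_k})}\Big)_{k\in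 K}\ {}_{\mathbb D_S}\Big)\longrightarrow\mathbb D\big(({}^{D_i}_{X_i})_{i\in I}\,{}_{X}\big),$$ and $\Theta(S)$ is an isomorphism. (2) Since $X_s\subset X_k$ for $s\in S$ and $k\in K$, each $X_s$ is a closed subscheme of $X_k$, and (1) holds in the same way, with unique $X$-morphisms, for the inner spaces $\mathbb D\big(({}^{D_s}_{X_s})_{s\in S}\,{}_{X_k}\big)$ in place of $\mathbb D\big(({}^{D_s}_{X_s\cap X_k})_{s\in S}\,{}_{X_k}\big)$, so that $\Theta(S)$ can be reformulated as an isomorphism $$\Theta(S):\ \mathbb D\Big(\Big({}^{D_k}_{\mathbb D(({}^{D_s}_{X_s})_{s\in S}\,{}_{X_k})}\Big)_{k\in K}\ {}_{\mathbb D_S}\Big)\longrightarrow\mathbb D\big(({}^{D_i}_{X_i})_{i\in I}\,{}_{X}\big).$$ More precisely, for every $k\in K$ there is a unique $X_k$-morphism between the two kinds of inner spaces, from the first to the second; it is an isomorphism and compatible with the closed immersions into $\mathbb D_S$. There is also a unique $X$-morphism from the source of $\Theta(S)$ in (1) to its source in (2); it is an isomorphism and compatible with the two forms of $\Theta(S)$.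 -/

import Mathlib

open CategoryTheory Limits AlgebraicGeometry

universe u v

noncomputable section

namespace AlgebraicGeometry.Scheme

/-- Restriction of sections of the structure sheaf, as a ring homomorphism. -/
abbrev res {X : Scheme.{u}} {V U : X.Opens} (h : V ≤ U) : Γ(X, U) →+* Γ(X, V) :=
  (X.presheaf.map (homOfLE h).op).hom

section Res

variable {X : Scheme.{u}}

lemma res_res {U V W : X.Opens} (h : V ≤ U) (h' : W ≤ V) (x : Γ(X, U)) :
    res h' (res h x) = res (h'.trans h) x := by
  simp only [res, ← CommRingCat.comp_apply, ← Functor.map_comp, ← op_comp, homOfLE_comp]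

lemma res_self {U : X.Opens} (h : U ≤ U) (x : Γ(X, U)) : res h x = x := by
  simp [res]

lemma res_surj_of_qcqs {U V : X.Opens} (hU : IsCompact U.1) (hU' : IsQuasiSeparated U.1)
    (f : Γ(X, U)) (hV : X.basicOpen f = V) (h : V ≤ U) (z : Γ(X, V)) :
    ∃ (n : ℕ) (y : Γ(X, U)), res h y = res h f ^ n * z := by
  subst hV
  exact exists_eq_pow_mul_of_isCompact_of_isQuasiSeparated X U hU hU' f z

lemma res_inj_of_qc {U V : X.Opens} (hU : IsCompact U.1)
    (f : Γ(X, U)) (hV : X.basicOpen f = V) (h : V ≤ U) (y : Γ(X, U)) (hy : res h y = 0) :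
    ∃ n : ℕ, f ^ n * y = 0 := by
  subst hV
  exact exists_pow_mul_eq_zero_of_res_basicOpen_eq_zero_of_isCompact X hU _ _ hy

end Res

lemma fg_map_away {R R' : Type u} [CommRing R] [CommRing R'] (φ : R →+* R') (I : Ideal R) (f : R)
    (hφ : letI := φ.toAlgebra; IsLocalization.Away f R') (h : (I.map φ).FG) :
    (I.map (algebraMap R (Localization.Away f))).FG := by
  let := φ.toAlgebra
  let e : R' ≃ₐ[R] Localization.Away f := IsLocalization.algEquiv (.powers f) _ _
  have : I.map (algebraMap _ (Localization.Away f)) = (I.map φ).map e.toAlgHom.toRingHom := by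
    rw [Ideal.map_map]
    congr 1
    exact e.toAlgHom.comp_algebraMap.symm
  rw [this]
  exact h.map _

namespace IdealSheafData

variable {X Y : Scheme.{u}}

/-- A closed subscheme (given by its ideal sheaf `J`) is locally principal if its ideal is
locally generated by one element. -/
def IsLocallyPrincipal (J : X.IdealSheafData) : Prop :=
  ∀ x : X, ∃ U : X.affineOpens, x ∈ U.1 ∧ ∃ a : Γ(X, U), J.ideal U = Ideal.span {a}

/-- A closed subscheme (given by its ideal sheaf `J`) is a Cartier divisor if its ideal is
locally generated by one element which is not a zero divisor. -/
def IsCartier (J : X.IdealSheafData) : Prop :=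
  ∀ x : X, ∃ U : X.affineOpens, x ∈ U.1 ∧
    ∃ a ∈ nonZeroDivisors Γ(X, U), J.ideal U = Ideal.span {a}

lemma ideal_eq_span_of_le {J : X.IdealSheafData} {U V : X.affineOpens} (h : V ≤ U)
    {a : Γ(X, U)} (ha : J.ideal U = Ideal.span {a}) :
    J.ideal V = Ideal.span {res h a} := by
  rw [← J.map_ideal h, ha, Ideal.map_span, Set.image_singleton]
  rfl

lemma IsLocallyPrincipal.one : (1 : X.IdealSheafData).IsLocallyPrincipal := by
  intro x
  obtain ⟨_, ⟨U, hU, rfl⟩, hxU, -⟩ :=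
    X.isBasis_affineOpens.exists_subset_of_mem_open (Set.mem_univ x) isOpen_univ
  exact ⟨⟨U, hU⟩, hxU, 1, by simp⟩

lemma IsLocallyPrincipal.mul {J K : X.IdealSheafData} (hJ : J.IsLocallyPrincipal)
    (hK : K.IsLocallyPrincipal) : (J * K).IsLocallyPrincipal := by
  intro x
  obtain ⟨U, hxU, a, ha⟩ := hJ x
  obtain ⟨V, hxV, b, hb⟩ := hK x
  obtain ⟨_, ⟨W, hW, rfl⟩, hxW, hWU⟩ :=
    X.isBasis_affineOpens.exists_subset_of_mem_open (show x ∈ (U.1 ⊓ V.1 : X.Opens) from ⟨hxU, hxV⟩)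
      (U.1 ⊓ V.1).isOpen
  have h1 : (⟨W, hW⟩ : X.affineOpens) ≤ U := fun y hy ↦ (hWU hy).1
  have h2 : (⟨W, hW⟩ : X.affineOpens) ≤ V := fun y hy ↦ (hWU hy).2
  refine ⟨⟨W, hW⟩, hxW, res h1 a * res h2 b, ?_⟩
  rw [ideal_mul, Pi.mul_apply, ideal_eq_span_of_le h1 ha, ideal_eq_span_of_le h2 hb,
    Ideal.span_singleton_mul_span_singleton]

lemma IsLocallyPrincipal.prod {ι : Type*} (s : Finset ι) (J : ι → X.IdealSheafData)
    (h : ∀ i ∈ s, (J i).IsLocallyPrincipal) : (∏ i ∈ s, J i).IsLocallyPrincipal :=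
  Finset.prod_induction _ _ (fun _ _ ↦ IsLocallyPrincipal.mul) .one h

lemma IsLocallyPrincipal.fg {J : X.IdealSheafData} (hJ : J.IsLocallyPrincipal)
    (U : X.affineOpens) : (J.ideal U).FG := by
  let t : Set Γ(X, U) := {f | ∃ a : Γ(X, X.affineBasicOpen f),
    J.ideal (X.affineBasicOpen f) = Ideal.span {a}}
  have ht : Ideal.span t = ⊤ := by
    rw [← U.2.self_le_iSup_basicOpen_iff]
    intro x hx
    obtain ⟨V, hxV, a, ha⟩ := hJ x
    obtain ⟨f, hf, hxf⟩ := U.2.exists_basicOpen_le ⟨x, hxV⟩ hx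
    simp only [TopologicalSpace.Opens.mem_iSup]
    exact ⟨⟨f, _, ideal_eq_span_of_le (V := X.affineBasicOpen f) hf ha⟩, hxf⟩
  refine Ideal.fg_of_localizationSpan t ht fun ⟨f, a, ha⟩ ↦ ?_
  refine fg_map_away (res (X.basicOpen_le f)) (J.ideal U) f
    (U.2.isLocalization_of_eq_basicOpen _ _ rfl) ?_
  refine ⟨{a}, Eq.trans (congrArg _ (Finset.coe_singleton _)) ?_⟩
  exact ha.symm.trans (J.map_ideal_basicOpen U f).symm

lemma exists_mem_ideal (K : X.IdealSheafData) {U V : X.affineOpens} (h : V ≤ U) (f : Γ(X, U)) (hV : X.basicOpen f = V.1)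
    {m : Γ(X, V)} (hm : m ∈ K.ideal V) :
    ∃ (n : ℕ), ∃ m' ∈ K.ideal U, res h m' = res h f ^ n * m := by
  rw [← K.map_ideal h] at hm
  induction hm using Submodule.span_induction with
  | mem x hx =>
    obtain ⟨a, ha, rfl⟩ := hx
    exact ⟨0, a, ha, by rw [pow_zero, one_mul]; rfl⟩
  | zero => exact ⟨0, 0, zero_mem _, by rw [map_zero, mul_zero]⟩
  | add x y _ _ hx hy =>
    obtain ⟨n, x', hx', hx⟩ := hx
    obtain ⟨m, y', hy', hy⟩ := hy
    refine ⟨n + m, f ^ m * x' + f ^ n * y',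
      add_mem (Ideal.mul_mem_left _ _ hx') (Ideal.mul_mem_left _ _ hy'), ?_⟩
    rw [map_add, map_mul, map_mul, hx, hy, map_pow, map_pow]
    ring
  | smul c x _ hx =>
    obtain ⟨n, x', hx', hx⟩ := hx
    obtain ⟨m, y, hy⟩ := res_surj_of_qcqs U.2.isCompact U.2.isQuasiSeparated f hV h c
    refine ⟨m + n, y * x', Ideal.mul_mem_left _ _ hx', ?_⟩
    rw [map_mul, hx, hy, smul_eq_mul]
    ring

lemma comap_iso_inv_span {R S : CommRingCat.{u}} (e : R ≅ S) (K : Ideal R) (a : R)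
    (h : K = Ideal.span {a}) : K.comap e.inv.hom = Ideal.span {e.hom a} := by
  have := Ideal.comap_symm (I := K) e.commRingCatIsoToRingEquiv
  rw [h, Ideal.map_span, Set.image_singleton] at this
  rw [h]
  exact this

lemma ideal_comap_of_isAffine [IsAffine X] [IsAffine Y] (K : Y.IdealSheafData) (f : X ⟶ Y) :
    (K.comap f).ideal ⟨⊤, isAffineOpen_top X⟩ =
      (K.ideal ⟨⊤, isAffineOpen_top Y⟩).map f.appTop.hom := by
  apply le_antisymm
  · let L : X.IdealSheafData := ofIdealTop ((K.ideal ⟨⊤, isAffineOpen_top Y⟩).map f.appTop.hom)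
    have hL : L.ideal ⟨⊤, isAffineOpen_top X⟩ =
      (K.ideal ⟨⊤, isAffineOpen_top Y⟩).map f.appTop.hom := by simp [L]
    rw [← hL]
    suffices K.comap f ≤ L from this _
    rw [← le_map_iff_comap_le]
    refine le_of_isAffine ?_
    rw [ideal_map_of_isAffineHom, ← Ideal.map_le_iff_le_comap]
    exact hL.ge
  · rw [Ideal.map_le_iff_le_comap]
    refine (K.le_map_comap f ⟨⊤, isAffineOpen_top Y⟩).trans ?_
    rw [ideal_map_of_isAffineHom]
    rfl

lemma IsLocallyPrincipal.comap {J : Y.IdealSheafData} (hJ : J.IsLocallyPrincipal) (f : X ⟶ Y) :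
    (J.comap f).IsLocallyPrincipal := by
  intro x
  obtain ⟨U, hxU, a, ha⟩ := hJ (f x)
  obtain ⟨V, hV, hxV, hVU⟩ : ∃ V : X.Opens, IsAffineOpen V ∧ x ∈ V ∧ V ≤ f ⁻¹ᵁ U.1 := by
    obtain ⟨_, ⟨V, hV, rfl⟩, hxV, hVU⟩ :=
      X.isBasis_affineOpens.exists_subset_of_mem_open (show x ∈ f ⁻¹ᵁ U.1 from hxU)
        (f ⁻¹ᵁ U.1).isOpen
    exact ⟨V, hV, hxV, hVU⟩
  have : IsAffine V := hV
  have : IsAffine U.1 := U.2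
  let g : V.toScheme ⟶ U.1.toScheme := f.resLE U.1 V hVU
  let tV : V.toScheme.affineOpens := ⟨⊤, isAffineOpen_top _⟩
  let tU : U.1.toScheme.affineOpens := ⟨⊤, isAffineOpen_top _⟩
  have hU : ∃ b, (J.comap U.1.ι).ideal tU = Ideal.span {b} := by
    rw [ideal_comap_of_isOpenImmersion]
    refine ⟨_, comap_iso_inv_span (U.1.ι.appIso tU.1) _ _ (ideal_eq_span_of_le ?_ ha)⟩
    exact (Scheme.Opens.ι_image_top U.1).le
  obtain ⟨b, hb⟩ := hU
  have e : (J.comap f).comap V.ι = (J.comap U.1.ι).comap g := by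
    rw [← comap_comp, ← comap_comp, Scheme.Hom.resLE_comp_ι]
  have h1 : ((J.comap f).comap V.ι).ideal tV = Ideal.span {g.appTop b} := by
    rw [e, ideal_comap_of_isAffine, hb, Ideal.map_span, Set.image_singleton]
  rw [ideal_comap_of_isOpenImmersion] at h1
  refine ⟨⟨V.ι ''ᵁ ⊤, tV.2.image_of_isOpenImmersion V.ι⟩, ⟨⟨x, hxV⟩, trivial, rfl⟩, ?_⟩
  have h2 := comap_iso_inv_span (V.ι.appIso tV.1).symm _ _ h1
  rw [Ideal.comap_comap] at h2
  refine ⟨_, Eq.trans ?_ h2⟩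
  rw [← CommRingCat.hom_comp, Iso.symm_inv, Iso.hom_inv_id]
  exact (Ideal.comap_id _).symm

end IdealSheafData

section Dilatation

variable {X : Scheme.{u}} {I : Type v} [Fintype I]

variable (X I) in
/-- A multi-center on `X`: a family of pairs `[Yᵢ, Dᵢ]` of closed subschemes of `X`
(given by their ideal sheaves) with every `Dᵢ` locally principal. -/
structure MultiCenter where
  /-- the ideal sheaf of `Yᵢ` -/
  center : I → X.IdealSheafData
  /-- the ideal sheaf of `Dᵢ` -/
  divisor : I → X.IdealSheafData
  isLocallyPrincipal : ∀ i, (divisor i).IsLocallyPrincipal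

namespace MultiCenter

variable (C : X.MultiCenter I)

/-- The open complement of the union of the `Dᵢ`. If `U` is affine and `Dᵢ` has equation
`aᵢ` on `U`, then the sections over `U ⊓ C.away` form the localization `Γ(X, U)[aᵢ⁻¹ | i ∈ I]`. -/
def away : X.Opens := (∏ i, C.divisor i).support.compl

/-- The fractions `m / a` with `a` an equation of `Dᵢ` and `m` a section of the ideal of `Yᵢ`:
those `g` such that `a * g` belongs to (the image of) the ideal of `Yᵢ` for all `a` in the
ideal of `Dᵢ`. -/
def fractions (U : X.affineOpens) (i : I) : Set Γ(X, U.1 ⊓ C.away) :=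
  {g | ∀ a ∈ (C.divisor i).ideal U, ∃ m ∈ (C.center i).ideal U,
    res inf_le_left a * g = res inf_le_left m}

/-- The ring of sections over an affine open `U` of the dilatation: the `Γ(X, U)`-subalgebra of
`Γ(X, U ⊓ C.away)` generated by the fractions `m / aᵢ` with `m` in the ideal of `Yᵢ`, `i ∈ I`. -/
def dilatationRing (U : X.affineOpens) : Subring Γ(X, U.1 ⊓ C.away) :=
  Subring.closure (Set.range (res inf_le_left : Γ(X, U) →+* Γ(X, U.1 ⊓ C.away)) ∪
    ⋃ i, C.fractions U i)

/-- If the ideal of `Dᵢ` is generated by `a`, then the fractions are the `g` with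
`a * g = m` for some `m` in the ideal of `Yᵢ`. -/
lemma fractions_eq (U : X.affineOpens) (i : I) {a : Γ(X, U)}
    (ha : (C.divisor i).ideal U = Ideal.span {a}) :
    C.fractions U i = {g | ∃ m ∈ (C.center i).ideal U,
      res inf_le_left a * g = res inf_le_left m} := by
  ext g
  refine ⟨fun h ↦ h a (ha ▸ Ideal.mem_span_singleton_self a), fun ⟨m, hm, h⟩ b hb ↦ ?_⟩
  rw [ha, Ideal.mem_span_singleton'] at hb
  obtain ⟨c, rfl⟩ := hb
  exact ⟨c * m, Ideal.mul_mem_left _ _ hm, by rw [map_mul, mul_assoc, h, map_mul]⟩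

lemma mem_fractions_of_span (U : X.affineOpens) (i : I) (s : Set Γ(X, U))
    (hs : (C.divisor i).ideal U = Ideal.span s) (g : Γ(X, U.1 ⊓ C.away))
    (h : ∀ a ∈ s, ∃ m ∈ (C.center i).ideal U, res inf_le_left a * g = res inf_le_left m) :
    g ∈ C.fractions U i := by
  intro b hb
  rw [hs] at hb
  induction hb using Submodule.span_induction with
  | mem x hx => exact h x hx
  | zero => exact ⟨0, zero_mem _, by simp⟩
  | add x y _ _ hx hy =>
    obtain ⟨m, hm, e⟩ := hx
    obtain ⟨m', hm', e'⟩ := hy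
    exact ⟨m + m', add_mem hm hm', by rw [map_add, add_mul, e, e', map_add]⟩
  | smul c x _ hx =>
    obtain ⟨m, hm, e⟩ := hx
    exact ⟨c * m, Ideal.mul_mem_left _ _ hm, by rw [smul_eq_mul, map_mul, mul_assoc, e, map_mul]⟩

lemma res_mem_fractions {U V : X.affineOpens} (h : V ≤ U) (i : I) {g : Γ(X, U.1 ⊓ C.away)}
    (hg : g ∈ C.fractions U i) :
    res (inf_le_inf_right C.away h) g ∈ C.fractions V i := by
  refine C.mem_fractions_of_span V i _ ((C.divisor i).map_ideal h).symm _ ?_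
  rintro _ ⟨a, ha, rfl⟩
  obtain ⟨m, hm, e⟩ := hg a ha
  refine ⟨res h m, (C.center i).ideal_le_comap_ideal h hm, ?_⟩
  have := congr(res (inf_le_inf_right C.away h) $e)
  rw [map_mul, res_res, res_res] at this
  rw [res_res]
  exact (congr($(res_res h inf_le_left a) * _)).trans this

lemma res_mem_dilatationRing {U V : X.affineOpens} (h : V ≤ U) {g : Γ(X, U.1 ⊓ C.away)}
    (hg : g ∈ C.dilatationRing U) :
    res (inf_le_inf_right C.away h) g ∈ C.dilatationRing V := by
  suffices H : C.dilatationRing U ≤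
      (C.dilatationRing V).comap (res (inf_le_inf_right C.away h)) from H hg
  refine Subring.closure_le.mpr (Set.union_subset ?_ (Set.iUnion_subset fun i g hg ↦ ?_))
  · rintro _ ⟨x, rfl⟩
    refine Subring.subset_closure (.inl ⟨res h x, ?_⟩)
    rw [res_res, res_res]
  · exact Subring.subset_closure (.inr (Set.mem_iUnion.mpr ⟨i, C.res_mem_fractions h i hg⟩))

/-- The sections of the dilatation over the affine opens of `X`, as a presheaf of rings. -/
def dilatationPresheaf : X.AffineZariskiSiteᵒᵖ ⥤ CommRingCat.{u} where
  obj U := .of (C.dilatationRing U.unop)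
  map {U V} i := CommRingCat.ofHom
    ((res (inf_le_inf_right C.away (AffineZariskiSite.toOpens_mono i.unop.le))).restrict
      (C.dilatationRing U.unop) (C.dilatationRing V.unop) fun _ hx ↦
        C.res_mem_dilatationRing (AffineZariskiSite.toOpens_mono i.unop.le) hx)
  map_id U := by
    refine CommRingCat.hom_ext (RingHom.ext fun x ↦ Subtype.ext ?_)
    exact res_self _ _
  map_comp i j := by
    refine CommRingCat.hom_ext (RingHom.ext fun x ↦ Subtype.ext ?_)
    exact (res_res _ _ _).symm

/-- The structure morphism of the dilatation on sections. -/
def toDilatationPresheaf :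
    (AffineZariskiSite.toOpensFunctor X).op ⋙ X.presheaf ⟶ C.dilatationPresheaf where
  app U := CommRingCat.ofHom ((res inf_le_left :
      Γ(X, U.unop.toOpens) →+* Γ(X, U.unop.toOpens ⊓ C.away)).codRestrict
    (C.dilatationRing U.unop) fun x ↦ Subring.subset_closure (.inl ⟨x, rfl⟩))
  naturality U V i := by
    ext x
    refine Subtype.ext ?_
    exact (res_res (AffineZariskiSite.toOpens_mono i.unop.le) inf_le_left x).trans
      (res_res inf_le_left _ x).symm

lemma isCompact_inf_away (U : X.affineOpens) : IsCompact (U.1 ⊓ C.away).1 := by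
  obtain ⟨s, hs⟩ := (IdealSheafData.IsLocallyPrincipal.prod Finset.univ C.divisor
    fun i _ ↦ C.isLocallyPrincipal i).fg U
  have : (U.1 ⊓ C.away).1 = ⋃ f ∈ s, (X.basicOpen f).1 := by
    ext x
    have hx (hxU : x ∈ U.1) := IdealSheafData.mem_support_iff_of_mem
      (I := ∏ i, C.divisor i) hxU
    rw [← hs, zeroLocus_span, mem_zeroLocus_iff] at hx
    have hx' (hxU : x ∈ U.1) : x ∈ C.away ↔ ∃ f ∈ s, x ∈ X.basicOpen f := by
      have : x ∈ C.away ↔ ¬ x ∈ (∏ i, C.divisor i).support := Iff.rfl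
      rw [this, hx hxU]
      simp
    simp only [Set.mem_iUnion, exists_prop]
    exact ⟨fun h ↦ (hx' h.1).mp h.2, fun ⟨f, hf, h⟩ ↦
      ⟨X.basicOpen_le f h, (hx' (X.basicOpen_le f h)).mpr ⟨f, hf, h⟩⟩⟩
  rw [this]
  exact s.finite_toSet.isCompact_biUnion fun f _ ↦ (U.2.basicOpen f).isCompact

lemma isQuasiSeparated_inf_away (U : X.affineOpens) : IsQuasiSeparated (U.1 ⊓ C.away).1 :=
  U.2.isQuasiSeparated.of_subset fun _ h ↦ h.1

lemma basicOpen_res_inf_away {U V : X.affineOpens} (h : V ≤ U) (f : Γ(X, U)) (hV : X.basicOpen f = V.1) :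
    X.basicOpen (res (inf_le_left : U.1 ⊓ C.away ≤ U.1) f) = V.1 ⊓ C.away := by
  rw [basicOpen_res, hV]
  ext x
  exact ⟨fun h ↦ ⟨h.2, h.1.2⟩, fun h' ↦ ⟨⟨h h'.1, h'.2⟩, h'.1⟩⟩

lemma exists_pow_mul_eq_res {U V : X.affineOpens} (h : V ≤ U) (f : Γ(X, U)) (hV : X.basicOpen f = V.1)
    (z : Γ(X, V.1 ⊓ C.away)) :
    ∃ (n : ℕ) (y : Γ(X, U.1 ⊓ C.away)), res (inf_le_inf_right C.away h) y =
      res (inf_le_left.trans h) f ^ n * z := by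
  obtain ⟨n, y, e⟩ := res_surj_of_qcqs (C.isCompact_inf_away U) (C.isQuasiSeparated_inf_away U)
    (res inf_le_left f) (C.basicOpen_res_inf_away h f hV) (inf_le_inf_right C.away h) z
  exact ⟨n, y, by rw [e, res_res]⟩

lemma exists_pow_mul_eq {U V : X.affineOpens} (h : V ≤ U) (f : Γ(X, U)) (hV : X.basicOpen f = V.1)
    (y z : Γ(X, U.1 ⊓ C.away))
    (e : res (inf_le_inf_right C.away h) y = res (inf_le_inf_right C.away h) z) :
    ∃ n : ℕ, res inf_le_left f ^ n * y = res inf_le_left f ^ n * z := by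
  obtain ⟨n, e⟩ := res_inj_of_qc (C.isCompact_inf_away U)
    (res inf_le_left f) (C.basicOpen_res_inf_away h f hV)
    (inf_le_inf_right C.away h) (y - z) (by rw [map_sub, e, sub_self])
  exact ⟨n, by rwa [mul_sub, sub_eq_zero] at e⟩

/-- Fractions over a basic open extend to the whole affine open, up to denominators. -/
lemma exists_fraction {U V : X.affineOpens} (h : V ≤ U) (f : Γ(X, U)) (hV : X.basicOpen f = V.1)
    (i : I) {g : Γ(X, V.1 ⊓ C.away)} (hg : g ∈ C.fractions V i) :
    ∃ (n : ℕ), ∃ y ∈ C.fractions U i, res (inf_le_inf_right C.away h) y =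
      res (inf_le_left.trans h) f ^ n * g := by
  obtain ⟨s, hs⟩ := (C.isLocallyPrincipal i).fg U
  obtain ⟨n₀, y₀, hy₀⟩ := C.exists_pow_mul_eq_res h f hV g
  have key (a : s) : ∃ (n : ℕ), ∃ m ∈ (C.center i).ideal U,
      res inf_le_left a.1 * (res inf_le_left f ^ n * y₀) = res inf_le_left m := by
    have ha : a.1 ∈ (C.divisor i).ideal U := hs ▸ Ideal.subset_span a.2
    obtain ⟨m, hm, e⟩ := hg _ ((C.divisor i).ideal_le_comap_ideal h ha)
    obtain ⟨k, m', hm', e'⟩ := IdealSheafData.exists_mem_ideal (C.center i) h f hV hm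
    obtain ⟨l, e''⟩ := C.exists_pow_mul_eq h f hV
      (res inf_le_left f ^ k * (res inf_le_left a.1 * y₀)) (res inf_le_left (f ^ n₀ * m')) (by
        have e₁ := congr(res (inf_le_left : V.1 ⊓ C.away ≤ V.1) $e')
        rw [map_mul, map_pow, res_res, res_res] at e₁
        have e₂ : res (inf_le_left.trans h) a.1 * g =
          res (inf_le_left : V.1 ⊓ C.away ≤ V.1) m := 
            (congr($(res_res h inf_le_left a.1) * g)).symm.trans e
        rw [map_mul, map_mul, map_pow, hy₀, res_res, res_res, res_res, map_mul, map_pow, e₁, ← e₂]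
        ring)
    refine ⟨l + k, f ^ l * (f ^ n₀ * m'),
      Ideal.mul_mem_left _ _ (Ideal.mul_mem_left _ _ hm'), ?_⟩
    rw [map_mul, map_pow, ← e'']
    ring
  choose N m hm e using key
  let n := s.attach.sup N
  refine ⟨n + n₀, res inf_le_left f ^ n * y₀, C.mem_fractions_of_span U i s hs.symm _ ?_, ?_⟩
  · intro a ha
    have hle : N ⟨a, ha⟩ ≤ n := Finset.le_sup (f := N) (Finset.mem_attach _ _)
    refine ⟨f ^ (n - N ⟨a, ha⟩) * m ⟨a, ha⟩, Ideal.mul_mem_left _ _ (hm _), ?_⟩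
    rw [map_mul, ← e, map_pow]
    have : n = (n - N ⟨a, ha⟩) + N ⟨a, ha⟩ := (Nat.sub_add_cancel hle).symm
    conv_lhs => rw [this, pow_add]
    ring
  · rw [map_mul, map_pow, hy₀, res_res]
    ring

lemma exists_mem_dilatationRing {U V : X.affineOpens} (h : V ≤ U) (f : Γ(X, U)) (hV : X.basicOpen f = V.1)
    {g : Γ(X, V.1 ⊓ C.away)} (hg : g ∈ C.dilatationRing V) :
    ∃ (n : ℕ), ∃ y ∈ C.dilatationRing U, res (inf_le_inf_right C.away h) y =
      res (inf_le_left.trans h) f ^ n * g := by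
  have hf (n : ℕ) : (res inf_le_left f : Γ(X, U.1 ⊓ C.away)) ^ n ∈ C.dilatationRing U :=
    pow_mem (Subring.subset_closure (.inl ⟨f, rfl⟩)) n
  have hr (n : ℕ) : res (inf_le_inf_right C.away h)
      ((res inf_le_left f : Γ(X, U.1 ⊓ C.away)) ^ n) = res (inf_le_left.trans h) f ^ n := by
    rw [map_pow, res_res]
  induction hg using Subring.closure_induction with
  | mem x hx =>
    rcases hx with ⟨x, rfl⟩ | hx
    · obtain ⟨n, y, e⟩ := res_surj_of_qcqs U.2.isCompact U.2.isQuasiSeparated f hV h x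
      refine ⟨n, res inf_le_left y, Subring.subset_closure (.inl ⟨y, rfl⟩), ?_⟩
      have := congr(res (inf_le_left : V.1 ⊓ C.away ≤ _) $e)
      rw [map_mul, map_pow, res_res, res_res] at this
      rw [res_res]
      exact this
    · obtain ⟨i, hi⟩ := Set.mem_iUnion.mp hx
      obtain ⟨n, y, hy, e⟩ := C.exists_fraction h f hV i hi
      exact ⟨n, y, Subring.subset_closure (.inr (Set.mem_iUnion.mpr ⟨i, hy⟩)), e⟩
  | zero => exact ⟨0, 0, zero_mem _, by rw [map_zero, mul_zero]⟩
  | one => exact ⟨0, 1, one_mem _, by rw [map_one, pow_zero, one_mul]⟩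
  | add x y _ _ hx hy =>
    obtain ⟨n, x', hx', hx⟩ := hx
    obtain ⟨m, y', hy', hy⟩ := hy
    refine ⟨n + m, res inf_le_left f ^ m * x' + res inf_le_left f ^ n * y',
      add_mem (mul_mem (hf m) hx') (mul_mem (hf n) hy'), ?_⟩
    rw [map_add, map_mul, map_mul, hx, hy, hr, hr]
    ring
  | neg x _ hx =>
    obtain ⟨n, x', hx', hx⟩ := hx
    refine ⟨n, -x', neg_mem hx', ?_⟩
    rw [map_neg, hx, mul_neg]
  | mul x y _ _ hx hy =>
    obtain ⟨n, x', hx', hx⟩ := hx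
    obtain ⟨m, y', hy', hy⟩ := hy
    refine ⟨n + m, x' * y', mul_mem hx' hy', ?_⟩
    rw [map_mul, hx, hy]
    ring

lemma isLocalization_dilatationRing {U V : X.affineOpens} (h : V ≤ U) (f : Γ(X, U)) (hV : X.basicOpen f = V.1) :
    letI := ((res (inf_le_inf_right C.away h)).restrict (C.dilatationRing U) (C.dilatationRing V)
      fun _ hx ↦ C.res_mem_dilatationRing h hx).toAlgebra
    IsLocalization.Away ((res inf_le_left : Γ(X, U) →+* Γ(X, U.1 ⊓ C.away)).codRestrict
      (C.dilatationRing U) (fun x ↦ Subring.subset_closure (.inl ⟨x, rfl⟩)) f)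
      (C.dilatationRing V) := by
  let ρ := (res (inf_le_inf_right C.away h)).restrict (C.dilatationRing U) (C.dilatationRing V)
      fun _ hx ↦ C.res_mem_dilatationRing h hx
  let := ρ.toAlgebra
  let γU := (res inf_le_left : Γ(X, U) →+* Γ(X, U.1 ⊓ C.away)).codRestrict
      (C.dilatationRing U) (fun x ↦ Subring.subset_closure (.inl ⟨x, rfl⟩))
  let γV := (res inf_le_left : Γ(X, V) →+* Γ(X, V.1 ⊓ C.away)).codRestrict
      (C.dilatationRing V) (fun x ↦ Subring.subset_closure (.inl ⟨x, rfl⟩))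
  have hργ (x : Γ(X, U)) : ρ (γU x) = γV (res h x) :=
    Subtype.ext ((res_res _ _ _).trans (res_res _ _ _).symm)
  have hu : IsUnit (ρ (γU f)) := by
    rw [hργ]
    refine RingHom.isUnit_map _ ?_
    obtain ⟨U, hU⟩ := U
    obtain ⟨V, hV'⟩ := V
    obtain rfl : X.basicOpen f = V := hV
    exact RingedSpace.isUnit_res_basicOpen _ f
  refine ⟨⟨?_, ?_, ?_⟩⟩
  · rintro ⟨_, n, rfl⟩
    exact (map_pow ρ (γU f) n) ▸ hu.pow n
  · rintro ⟨z, hz⟩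
    obtain ⟨n, y, hy, e⟩ := C.exists_mem_dilatationRing h f hV hz
    refine ⟨(⟨y, hy⟩, ⟨_, n, rfl⟩), Subtype.ext ?_⟩
    refine Eq.trans ?_ e.symm
    rw [mul_comm, ← res_res inf_le_left (inf_le_inf_right C.away h), ← map_pow]
    rfl
  · rintro ⟨x, hx⟩ ⟨y, hy⟩ e
    obtain ⟨n, e'⟩ := C.exists_pow_mul_eq h f hV x y congr(($e).1)
    exact ⟨⟨_, n, rfl⟩, Subtype.ext e'⟩

lemma coequifibered_toDilatationPresheaf : C.toDilatationPresheaf.Coequifibered :=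
  AffineZariskiSite.coequifibered_iff_forall_isLocalizationAway.mpr fun U f ↦
    C.isLocalization_dilatationRing (U := U) (V := U.basicOpen f) (X.basicOpen_le f) f rfl

/-- The dilatation `Bl {Dᵢ / Yᵢ} X` with its structure morphism to `X`: the relative spectrum of
the quasi-coherent algebra with sections `C.dilatationRing U` over affine opens `U`. -/
def dilatation : Over X :=
  Over.mk (AffineZariskiSite.relativeGluingData C.coequifibered_toDilatationPresheaf).toBase

end MultiCenter

end Dilatation

section DeformationSpace

variable {X : Scheme.{u}} {I : Type v} [LinearOrder I] [Fintype I]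

/-- The deformation space `𝔻((Dᵢ over Xᵢ)_{i ∈ I}, X)`: the dilatation of `X` with multi-center
`{[Xᵢ, ∑_{j ≥ i} Dⱼ]}_{i ∈ I}`, as an `X`-scheme. The closed subschemes `Xᵢ` and `Dᵢ` are given
by their ideal sheaves `Z i` and `D i`; the sum of closed subschemes is the product of ideals. -/
def deformationSpace (Z D : I → X.IdealSheafData) (hD : ∀ i, (D i).IsLocallyPrincipal) : Over X :=
  MultiCenter.dilatation
    { center := Z
      divisor := fun i ↦ ∏ j with i ≤ j, D j
      isLocallyPrincipal := fun _ ↦ .prod _ _ fun j _ ↦ hD j }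

variable (X I) in
/-- A deformation datum on `X` indexed by a finite totally ordered set `I`: a decreasing family
of closed subschemes `Xᵢ` and a family of locally principal closed subschemes `Dᵢ` of `X`,
given by their ideal sheaves (so the inclusions are reversed). -/
structure DeformationDatum where
  /-- the ideal sheaf of `Xᵢ` -/
  Z : I → X.IdealSheafData
  /-- the ideal sheaf of `Dᵢ` -/
  D : I → X.IdealSheafData
  monotone : Monotone Z
  isLocallyPrincipal : ∀ i, (D i).IsLocallyPrincipal

namespace DeformationDatum

variable (𝒳 : X.DeformationDatum I) (S : Finset I)

/-- The closed subscheme `Xᵢ` of `X`. -/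
abbrev sub (i : I) : Scheme.{u} := (𝒳.Z i).subscheme

/-- The closed immersion `Xᵢ ⟶ X`. -/
abbrev subι (i : I) : 𝒳.sub i ⟶ X := (𝒳.Z i).subschemeι

/-- `Xᵢ ∩ Dⱼ` is a Cartier divisor in `Xᵢ` for all `i` and `j`. -/
def IsCartier : Prop :=
  ∀ i j, ((𝒳.D j).comap (𝒳.subι i)).IsCartier

/-- The deformation space `𝔻((Dᵢ over Xᵢ)_{i ∈ I}, X)`. -/
def space : Over X :=
  deformationSpace 𝒳.Z 𝒳.D 𝒳.isLocallyPrincipal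

/-- The deformation space `𝔻((D_s over X_s)_{s ∈ S}, X)`. -/
def outer : Over X :=
  deformationSpace (fun s : S ↦ 𝒳.Z s) (fun s ↦ 𝒳.D s) (fun s ↦ 𝒳.isLocallyPrincipal s)

/-- The deformation space `𝔻((D_s over X_s ∩ X_k)_{s ∈ S}, X_k)`, as an `X_k`-scheme. -/
def inner (k : I) : Over (𝒳.sub k) :=
  deformationSpace (fun s : S ↦ (𝒳.Z s).comap (𝒳.subι k)) (fun s ↦ (𝒳.D s).comap (𝒳.subι k))
    (fun s ↦ (𝒳.isLocallyPrincipal s).comap _)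

/-- If `s ≥ k` for all `s ∈ S`, so that `X_s` is a closed subscheme of `X_k` through the
inclusion: the deformation space `𝔻((D_s over X_s)_{s ∈ S}, X_k)`, as an `X_k`-scheme. -/
def innerSub (k : I) (hk : ∀ s ∈ S, k ≤ s) : Over (𝒳.sub k) :=
  deformationSpace
    (fun s : S ↦ (IdealSheafData.inclusion (𝒳.monotone (hk s s.2)) : 𝒳.sub s ⟶ 𝒳.sub k).ker)
    (fun s ↦ (𝒳.D s).comap (𝒳.subι k)) (fun s ↦ (𝒳.isLocallyPrincipal s).comap _)

/-- For closed subschemes `Y_k`, `k ∉ S`, of `𝔻_S := 𝔻((D_s over X_s)_{s ∈ S}, X)` (given by their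
ideal sheaves), the deformation space `𝔻((D_k over Y_k)_{k ∉ S}, 𝔻_S)`, as an `X`-scheme. Here
`D_k` is pulled back to `𝔻_S`. -/
def panel (Y : ↥Sᶜ → (𝒳.outer S).left.IdealSheafData) : Over X :=
  (Over.map (𝒳.outer S).hom).obj
    (deformationSpace Y (fun k ↦ (𝒳.D k).comap (𝒳.outer S).hom)
      (fun k ↦ (𝒳.isLocallyPrincipal k).comap _))

/-- The regularity assumption on the datum and `S`. For closed subschemes with ideals `M` and `N`,
the ideals of the sum, the union and the intersection are `M * N`, `M ⊓ N` and `M ⊔ N`. The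
families `θ` and `γ` are indexed by all of `I`, but only the values of `θ` on
`{s ∈ S | k < s}` and of `γ` on `S` are used; in the first condition, `s'` is the least
`s ∈ S` with `k < s` and `θ s ≠ 0`. -/
def PanelizationAssumption : Prop :=
  ∀ k ∉ S, (∃ s ∈ S, k < s) →
    (∀ (θ : I → ℕ), ∀ s' ∈ S, k < s' → θ s' ≠ 0 → (∀ s ∈ S, k < s → θ s ≠ 0 → s' ≤ s) →
      (∏ s ∈ S with k < s, 𝒳.Z s ^ θ s) ⊓ 𝒳.Z k =
        (∏ s ∈ S with s' < s, 𝒳.Z s ^ θ s) * 𝒳.Z s' ^ (θ s' - 1) * 𝒳.Z k) ∧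
    (∀ (E : Type) (θ γ : E → I → ℕ),
      (⨆ e, (∏ s ∈ S, 𝒳.D s ^ γ e s) * ∏ s ∈ S with k < s, 𝒳.Z s ^ θ e s) ⊓ 𝒳.Z k =
        ⨆ e, (∏ s ∈ S, 𝒳.D s ^ γ e s) * ((∏ s ∈ S with k < s, 𝒳.Z s ^ θ e s) ⊓ 𝒳.Z k))

end DeformationDatum

end DeformationSpace

end AlgebraicGeometry.Scheme

end

/-! Everything rests on the universal property of a dilatation: an `X`-scheme `T` maps to it, and
then in exactly one way, once every `Dᵢ` pulls back to a Cartier divisor on `T` and the ideal of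
`Yᵢ` lands in that of `Dᵢ` (`IsAdmissible`, `exists_lift`, `hom_ext`). It is proved for rings from a
description by generators and torsion, then glued. For a deformation datum the condition says that
all `Dᵢ` are Cartier on `T` and `Zᵢ ⊆ ∏_{j ≥ i} Dⱼ` there. All uniqueness claims follow, and two
morphisms in opposite directions are automatically inverse. So it remains to see that each side of
`Θ(S)` satisfies the condition defining the other.

From the panel to the space: indices in `S` are settled already on `𝔻_S`. For `k ∉ S`, a section of
`Z_k` is divisible on `𝔻_S` by `D = ∏_{s ∈ S} d_s`, because `X_{min S} ⊆ X_k`. The quotient vanishes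
on the inner space at `k`, where the `d_s` are regular (`comap_Z_le`). The second dilatation makes
it divisible by `K = ∏_{j ∉ S, j ≥ k} d_j`, and `D * K = ∏_{j ≥ k} d_j` since `S` lies above its
complement.

From the space to the panel, (a) and (b) enter. Let `b` be a function on `𝔻_S` vanishing on the
inner space at `k`. Bringing fractions to a common denominator gives `D ^ N * b = x`, with `x` a sum
of elements of `∏ d_s ^ γ_s * ∏ Z_s ^ θ_s` where `γ_s + ∑_{r ≤ s} θ_r = N`
(`exists_mem_numerators`). The Cartier hypothesis on `X_k` forces `x ∈ Z_k` (`mem_Z_of_mem_ker`). By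
(b) the intersection with `Z_k` may be taken summand by summand, and by (a) it trades one factor
`Z_{s'}` for `Z_k`. On `T` this replaces the guaranteed divisor `c_{s'} = ∏_{j ≥ s'} d_j` by `c_k =
D * K`, and `c_{s'}` divides `D`, so a factor `K` is gained: `x` is divisible by `D ^ N * K`, hence
`b` by `K` (`map_numerators_inf_le`, `dvd_of_forall_mem`, `comap_ker_innerHom_le`).

For (2), the ideal of `X_s` in `X_k` is the pullback of the ideal of `X_s` in `X`, so the two inner
spaces are equal. -/

namespace AlgebraicGeometry

/-! ### Dilatations of rings and their universal property. -/

/-- `φ : A →+* B` exhibits `B` as the dilatation of `A` with multi-center `[M i, a i]`. -/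
structure IsDilatation {A B ι : Type*} [CommRing A] [CommRing B] (φ : A →+* B)
    (M : ι → Ideal A) (a : ι → A) : Prop where
  mem_nonZeroDivisors : ∀ i, φ (a i) ∈ nonZeroDivisors B
  torsion : ∀ x, φ x = 0 → ∃ t ∈ Submonoid.closure (Set.range a), t * x = 0
  exists_fraction : ∀ i, ∀ m ∈ M i, ∃ g, φ (a i) * g = φ m
  closure_eq_top :
    Subring.closure (Set.range φ ∪ {g | ∃ i, ∃ m ∈ M i, φ (a i) * g = φ m}) = ⊤

lemma closure_range_map_mem_nonZeroDivisors {A R ι : Type*} [CommRing A] [CommRing R] {a : ι → A}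
    {ψ : A →+* R} (hψ : ∀ i, ψ (a i) ∈ nonZeroDivisors R) {t : A}
    (ht : t ∈ Submonoid.closure (Set.range a)) : ψ t ∈ nonZeroDivisors R := by
  suffices Submonoid.closure (Set.range a) ≤ (nonZeroDivisors R).comap ψ from this ht
  exact Submonoid.closure_le.mpr (by rintro _ ⟨i, rfl⟩; exact hψ i)

namespace IsDilatation

variable {A B R ι : Type*} [CommRing A] [CommRing B] [CommRing R] {φ : A →+* B}
  {M : ι → Ideal A} {a : ι → A}

lemma map_mem_nonZeroDivisors (h : IsDilatation φ M a) {t : A}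
    (ht : t ∈ Submonoid.closure (Set.range a)) : φ t ∈ nonZeroDivisors B :=
  closure_range_map_mem_nonZeroDivisors h.mem_nonZeroDivisors ht

/-- Both properties hold for the generators and survive sums and products. Carrying `ψ t ∣ ψ x`
through the induction is what later supplies the value of the lift of `ψ` at `b`; with `ψ = φ` the
lemma is plain clearing of denominators. -/
lemma exists_denominator (h : IsDilatation φ M a) {ψ : A →+* R}
    (hψ : ∀ i, ∀ m ∈ M i, ψ (a i) ∣ ψ m) (b : B) :
    ∃ t ∈ Submonoid.closure (Set.range a), ∃ x, φ t * b = φ x ∧ ψ t ∣ ψ x := by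
  have hb : b ∈ Subring.closure (Set.range φ ∪ {g | ∃ i, ∃ m ∈ M i, φ (a i) * g = φ m}) :=
    h.closure_eq_top ▸ trivial
  induction hb using Subring.closure_induction with
  | mem b hb =>
    obtain ⟨x, rfl⟩ | ⟨i, m, hm, e⟩ := hb
    · exact ⟨1, one_mem _, x, by simp⟩
    · exact ⟨a i, Submonoid.subset_closure ⟨i, rfl⟩, m, e, hψ i m hm⟩
  | zero => exact ⟨1, one_mem _, 0, by simp⟩
  | one => exact ⟨1, one_mem _, 1, by simp⟩
  | add b c _ _ hb hc =>
    obtain ⟨t, ht, x, e, k⟩ := hb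
    obtain ⟨t', ht', x', e', k'⟩ := hc
    refine ⟨t * t', mul_mem ht ht', t' * x + t * x', ?_, ?_⟩
    · simp only [map_mul, map_add, ← e, ← e']
      ring
    · simp only [map_mul, map_add]
      exact dvd_add (mul_comm (ψ t) (ψ t') ▸ mul_dvd_mul_left _ k) (mul_dvd_mul_left _ k')
  | neg b _ hb =>
    obtain ⟨t, ht, x, e, k⟩ := hb
    exact ⟨t, ht, -x, by rw [mul_neg, e, map_neg], by rwa [map_neg, dvd_neg]⟩
  | mul b c _ _ hb hc =>
    obtain ⟨t, ht, x, e, k⟩ := hb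
    obtain ⟨t', ht', x', e', k'⟩ := hc
    refine ⟨t * t', mul_mem ht ht', x * x', ?_, ?_⟩
    · simp only [map_mul, ← e, ← e']
      ring
    · simpa only [map_mul] using mul_dvd_mul k k'

lemma hom_ext (h : IsDilatation φ M a) {χ χ' : B →+* R}
    (hχ : ∀ i, χ (φ (a i)) ∈ nonZeroDivisors R) (e : χ.comp φ = χ'.comp φ) : χ = χ' := by
  ext b
  obtain ⟨t, ht, x, hx, -⟩ := h.exists_denominator (ψ := φ)
    (fun i m hm ↦ (h.exists_fraction i m hm).imp fun _ ↦ Eq.symm) b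
  have ht' := closure_range_map_mem_nonZeroDivisors (ψ := χ.comp φ) hχ ht
  have e' (y : A) : χ (φ y) = χ' (φ y) := congr($e y)
  refine (mul_cancel_left_mem_nonZeroDivisors ht').mp ?_
  change χ (φ t) * χ b = χ (φ t) * χ' b
  rw [← map_mul, hx, e', e', ← map_mul, hx]

/-- The image of `b = x / t` has to be `ψ x / ψ t`. Two such presentations differ by torsion, which
`ψ` kills, so the value is independent of the choice (`uniq`), and each ring axiom amounts to
exhibiting one presentation. -/
lemma exists_lift (h : IsDilatation φ M a) {ψ : A →+* R}
    (hψ : ∀ i, ψ (a i) ∈ nonZeroDivisors R) (hψ' : ∀ i, ∀ m ∈ M i, ψ (a i) ∣ ψ m) :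
    ∃ χ : B →+* R, χ.comp φ = ψ := by
  have key (b : B) : ∃ r : R, ∃ t ∈ Submonoid.closure (Set.range a), ∃ x,
      φ t * b = φ x ∧ ψ t * r = ψ x := by
    obtain ⟨t, ht, x, e, r, hr⟩ := h.exists_denominator hψ' b
    exact ⟨r, t, ht, x, e, hr.symm⟩
  choose f hf using key
  have uniq {b : B} {r : R} {t x : A} (ht : t ∈ Submonoid.closure (Set.range a))
      (e : φ t * b = φ x) (e' : ψ t * r = ψ x) : f b = r := by
    obtain ⟨t', ht', x', k, k'⟩ := hf b
    have h0 : φ (t' * x - t * x') = 0 := by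
      rw [map_sub, map_mul, map_mul, ← e, ← k]
      ring
    obtain ⟨s, hs, h0⟩ := h.torsion _ h0
    have := congr(ψ $h0)
    rw [map_mul, map_zero] at this
    replace this := (mul_left_mem_nonZeroDivisors_eq_zero_iff
      (closure_range_map_mem_nonZeroDivisors hψ hs)).mp this
    rw [map_sub, map_mul, map_mul, ← e', ← k'] at this
    refine ((mul_cancel_left_mem_nonZeroDivisors
      (closure_range_map_mem_nonZeroDivisors hψ (mul_mem ht ht'))).mp ?_)
    rw [map_mul]
    linear_combination -this
  have hφ (x : A) : f (φ x) = ψ x := uniq (one_mem _) (t := 1) (x := x) (by simp) (by simp)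
  refine ⟨{ toFun := f, map_one' := ?_, map_zero' := ?_, map_mul' := ?_, map_add' := ?_ }, ?_⟩
  · rw [← φ.map_one, hφ, map_one]
  · intro b c
    obtain ⟨t, ht, x, k, k'⟩ := hf b
    obtain ⟨s, hs, y, l, l'⟩ := hf c
    refine uniq (mul_mem ht hs) (x := x * y) ?_ ?_
    · simp only [map_mul, ← k, ← l]
      ring
    · simp only [map_mul, ← k', ← l']
      ring
  · rw [← φ.map_zero, hφ, map_zero]
  · intro b c
    obtain ⟨t, ht, x, k, k'⟩ := hf b
    obtain ⟨s, hs, y, l, l'⟩ := hf c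
    refine uniq (mul_mem ht hs) (x := s * x + t * y) ?_ ?_
    · simp only [map_mul, map_add, ← k, ← l]
      ring
    · simp only [map_mul, map_add, ← k', ← l']
      ring
  · ext x
    exact hφ x

/-- Non-zero-divisors stay non-zero-divisors in a dilatation. -/
lemma map_mem_nonZeroDivisors_of_mem (h : IsDilatation φ M a) {d : A}
    (hd : d ∈ nonZeroDivisors A) : φ d ∈ nonZeroDivisors B := by
  refine mem_nonZeroDivisors_iff_right.mpr fun b hb ↦ ?_
  obtain ⟨t, ht, x, hx, -⟩ := h.exists_denominator (ψ := φ)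
    (fun i m hm ↦ (h.exists_fraction i m hm).imp fun _ ↦ Eq.symm) b
  obtain ⟨s, hs, e⟩ := h.torsion (x * d) (by rw [map_mul, ← hx, mul_assoc, hb, mul_zero])
  rw [← mul_assoc] at e
  replace e := congr(φ $(mem_nonZeroDivisors_iff_right.mp hd _ e))
  rw [map_mul, ← hx, ← mul_assoc, ← map_mul, map_zero] at e
  exact (mul_left_mem_nonZeroDivisors_eq_zero_iff
    (h.map_mem_nonZeroDivisors (mul_mem hs ht))).mp e

/-- Since `q` is surjective, every numerator in the extended center comes from one in `M i`. The
fraction it defines in `B` maps to the given one, because `φ' (q (a i))` can be cancelled. -/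
lemma surjective {A' B' : Type*} [CommRing A'] [CommRing B'] (h : IsDilatation φ M a)
    {q : A →+* A'} (hq : Function.Surjective q) {φ' : A' →+* B'}
    (h' : IsDilatation φ' (fun i ↦ (M i).map q) (fun i ↦ q (a i))) {F : B →+* B'}
    (hF : F.comp φ = φ'.comp q) : Function.Surjective F := by
  have hF' (x : A) : F (φ x) = φ' (q x) := congr($hF x)
  rw [← RingHom.range_eq_top, ← top_le_iff, ← h'.closure_eq_top, Subring.closure_le]
  rintro _ (⟨x, rfl⟩ | ⟨i, m, hm, e⟩)
  · obtain ⟨x, rfl⟩ := hq x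
    exact ⟨φ x, hF' x⟩
  · obtain ⟨m, hm', rfl⟩ := (Ideal.mem_map_iff_of_surjective q hq).mp hm
    obtain ⟨g, hg⟩ := h.exists_fraction i m hm'
    refine ⟨g, (mul_cancel_left_mem_nonZeroDivisors (h'.mem_nonZeroDivisors i)).mp ?_⟩
    rw [e, ← hF', ← map_mul, hg, hF']

end IsDilatation

/-! ### Common denominators in deformation rings and the key divisibility. -/

section Panel

variable {A : Type*} [CommRing A] {I : Type*} [LinearOrder I]
  (S : Finset I) (Z : I → Ideal A) (d : I → A)

/-- The numerators of the elements of the deformation ring of `(Z s, d s)`, `s ∈ S`,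
with denominator the `N`-th power of the product of the `d s`. -/
def numerators (N : ℕ) : Ideal A :=
  ⨆ p : {p : (I → ℕ) × (I → ℕ) // ∀ s ∈ S, p.2 s + ∑ r ∈ S with r ≤ s, p.1 r = N},
    (∏ s ∈ S, Ideal.span {d s} ^ p.1.2 s) * ∏ s ∈ S, Z s ^ p.1.1 s

variable {S Z d}

lemma mem_numerators {N : ℕ} (θ γ : I → ℕ) (h : ∀ s ∈ S, γ s + ∑ r ∈ S with r ≤ s, θ r = N) {x : A}
    (hx : x ∈ (∏ s ∈ S, Ideal.span {d s} ^ γ s) * ∏ s ∈ S, Z s ^ θ s) :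
    x ∈ numerators S Z d N :=
  Ideal.mem_iSup_of_mem (⟨(θ, γ), h⟩ :
    {p : (I → ℕ) × (I → ℕ) // ∀ s ∈ S, p.2 s + ∑ r ∈ S with r ≤ s, p.1 r = N}) hx

lemma numerators_mul_le (N N' : ℕ) :
    numerators S Z d N * numerators S Z d N' ≤ numerators S Z d (N + N') := by
  rw [numerators, numerators, Ideal.iSup_mul]
  refine iSup_le fun ⟨p, hp⟩ ↦ ?_
  rw [Ideal.mul_iSup]
  refine iSup_le fun ⟨q, hq⟩ x hx ↦ ?_
  refine mem_numerators (p.1 + q.1) (p.2 + q.2) (fun s hs ↦ ?_) ?_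
  · rw [← hp s hs, ← hq s hs]
    simp only [Pi.add_apply, Finset.sum_add_distrib]
    ring
  · simp only [Pi.add_apply, pow_add, Finset.prod_mul_distrib]
    convert hx using 1
    simp only
    ring

lemma prod_pow_mem_numerators (N : ℕ) : (∏ s ∈ S, d s) ^ N ∈ numerators S Z d N := by
  refine mem_numerators 0 (fun _ ↦ N) (by simp) ?_
  simp only [Pi.zero_apply, pow_zero, Finset.prod_const_one, mul_one, Ideal.span_singleton_pow,
    Ideal.prod_span_singleton, Finset.prod_pow]
  exact Ideal.mem_span_singleton_self _

variable {B C : Type*} [CommRing B] [CommRing C] {φ : A →+* B}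

lemma prod_univ_filter_le (S : Finset I) {R : Type*} [CommMonoid R] (f : I → R) (s : S) :
    ∏ j : S with s ≤ j, f j = ∏ j ∈ S with s.1 ≤ j, f j := by
  refine Finset.prod_bij (fun j _ ↦ j.1) (by simp) (fun _ _ _ _ ↦ Subtype.ext) ?_ (by simp)
  simp only [Finset.mem_filter]
  exact fun j hj ↦ ⟨⟨j, hj.1⟩, ⟨Finset.mem_univ _, hj.2⟩, rfl⟩

lemma exists_mem_numerators
    (h : IsDilatation φ (fun s : S ↦ Z s) (fun s : S ↦ ∏ j : S with s ≤ j, d j)) (b : B) :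
    ∃ N, ∃ x ∈ numerators S Z d N, φ (∏ s ∈ S, d s) ^ N * b = φ x := by
  have hb : b ∈ Subring.closure (Set.range φ ∪ {g | ∃ s : S, ∃ m ∈ Z s,
    φ (∏ j : S with s ≤ j, d j) * g = φ m}) := h.closure_eq_top ▸ trivial
  have range (x : A) : ∃ N, ∃ y ∈ numerators S Z d N, φ (∏ s ∈ S, d s) ^ N * φ x = φ y :=
    ⟨0, x, mem_numerators 0 0 (by simp) (by simp [-Ideal.one_eq_top]), by simp⟩
  induction hb using Subring.closure_induction with
  | mem b hb =>
    obtain ⟨x, rfl⟩ | ⟨s, m, hm, e⟩ := hb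
    · exact range x
    -- The fraction has denominator `∏_{j ≥ s} d_j`. Multiplying by the missing `d_j` gives the full
    -- product to the power 1, so `γ` is the indicator of the indices not above `s`.
    · refine ⟨1, (∏ j ∈ S with ¬ s.1 ≤ j, d j) * m, mem_numerators (Pi.single s.1 1)
        (fun j ↦ if s.1 ≤ j then 0 else 1) (fun j hj ↦ ?_) (Ideal.mul_mem_mul ?_ ?_), ?_⟩
      · rw [Finset.sum_pi_single']
        simp only [Finset.mem_filter, s.2, true_and]
        split_ifs <;> rfl
      · simp only [Ideal.span_singleton_pow, Ideal.prod_span_singleton, Finset.prod_filter]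
        rw [Ideal.mem_span_singleton]
        exact (Finset.prod_congr rfl fun j _ ↦ by split_ifs <;> simp_all).dvd
      · rw [Finset.prod_eq_single_of_mem s.1 s.2 (fun j _ hj ↦ by simp [hj])]
        simpa using hm
      · rw [map_mul, ← e, prod_univ_filter_le, pow_one, ← mul_assoc, ← map_mul, mul_comm (∏ _ ∈ _, _),
          Finset.prod_filter_mul_prod_filter_not]
  | zero => exact φ.map_zero ▸ range 0
  | one => exact φ.map_one ▸ range 1
  | add b c _ _ hb hc =>
    obtain ⟨N, x, hx, e⟩ := hb
    obtain ⟨N', x', hx', e'⟩ := hc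
    refine ⟨N + N', x * (∏ s ∈ S, d s) ^ N' + (∏ s ∈ S, d s) ^ N * x', add_mem ?_ ?_, ?_⟩
    · exact numerators_mul_le _ _ (Ideal.mul_mem_mul hx (prod_pow_mem_numerators _))
    · exact numerators_mul_le _ _ (Ideal.mul_mem_mul (prod_pow_mem_numerators _) hx')
    · rw [map_add, map_mul, map_mul, ← e, ← e', map_pow, map_pow]
      ring
  | neg b _ hb =>
    obtain ⟨N, x, hx, e⟩ := hb
    exact ⟨N, -x, neg_mem hx, by rw [mul_neg, e, map_neg]⟩
  | mul b c _ _ hb hc =>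
    obtain ⟨N, x, hx, e⟩ := hb
    obtain ⟨N', x', hx', e'⟩ := hc
    refine ⟨N + N', x * x', numerators_mul_le _ _ (Ideal.mul_mem_mul hx hx'), ?_⟩
    rw [map_mul, ← e, ← e']
    ring

variable [Fintype I]

/-- The numerators of the elements of the deformation ring that vanish on the closed subscheme
defined by `Z k` become divisible in the deformation ring of all of `I`. -/
lemma map_numerators_inf_le {k : I} (hk : k ∉ S) (hSK : ∀ k ∉ S, ∀ s ∈ S, k < s)
    (h₁ : ∀ (θ : I → ℕ), ∀ s' ∈ S, θ s' ≠ 0 → (∀ s ∈ S, θ s ≠ 0 → s' ≤ s) →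
      (∏ s ∈ S, Z s ^ θ s) ⊓ Z k =
        (∏ s ∈ S with s' < s, Z s ^ θ s) * Z s' ^ (θ s' - 1) * Z k)
    (h₂ : ∀ (E : Type) (θ γ : E → I → ℕ),
      (⨆ e, (∏ s ∈ S, Ideal.span {d s} ^ γ e s) * ∏ s ∈ S, Z s ^ θ e s) ⊓ Z k =
        ⨆ e, (∏ s ∈ S, Ideal.span {d s} ^ γ e s) * ((∏ s ∈ S, Z s ^ θ e s) ⊓ Z k))
    {ψ : A →+* C} (hψ : ∀ i, (Z i).map ψ ≤ Ideal.span {ψ (∏ j with i ≤ j, d j)}) (N : ℕ) :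
    (numerators S Z d N ⊓ Z k).map ψ ≤
      Ideal.span {ψ ((∏ s ∈ S, d s) ^ N * ∏ j ∈ Sᶜ with k ≤ j, d j)} := by
  let T := {p : (I → ℕ) × (I → ℕ) // ∀ s ∈ S, p.2 s + ∑ r ∈ S with r ≤ s, p.1 r = N}
  -- Assumption (b) only allows index sets in `Type`. As `I` is finite, `T` is countable and has a
  -- copy there.
  let τ : Shrink.{0} T ≃ T := (equivShrink.{0} T).symm
  have e := h₂ (Shrink.{0} T) (fun e ↦ (τ e).1.1) (fun e ↦ (τ e).1.2)
  rw [τ.iSup_comp (g := fun p : T ↦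
      (∏ s ∈ S, Ideal.span {d s} ^ p.1.2 s) * ∏ s ∈ S, Z s ^ p.1.1 s),
    τ.iSup_comp (g := fun p : T ↦
      (∏ s ∈ S, Ideal.span {d s} ^ p.1.2 s) * ((∏ s ∈ S, Z s ^ p.1.1 s) ⊓ Z k))] at e
  rw [numerators, e, Ideal.map_iSup]
  refine iSup_le fun ⟨⟨θ, γ⟩, hp⟩ ↦ ?_
  dsimp only at hp ⊢
  set c : I → A := fun i ↦ ∏ j with i ≤ j, d j
  set K := ∏ j ∈ Sᶜ with k ≤ j, d j
  have hck : c k = (∏ s ∈ S, d s) * K := by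
    simp only [c, K]
    rw [← Finset.prod_filter_mul_prod_filter_not _ (· ∈ S)]
    congr 1
    all_goals
      refine Finset.prod_congr ?_ fun _ _ ↦ rfl
      ext j
      have := hSK k hk j
      simp only [Finset.mem_filter, Finset.mem_univ, Finset.mem_compl, true_and]
      grind
  have hcs (s : I) (hs : s ∈ S) : c s = ∏ j ∈ S with s ≤ j, d j := by
    refine Finset.prod_congr ?_ fun _ _ ↦ rfl
    ext j
    simp only [Finset.mem_filter, Finset.mem_univ, true_and, iff_and_self]
    exact fun hj ↦ by_contra fun hj' ↦ (hSK j hj' s hs).not_ge hj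
  -- In `∏ c_s ^ θ_s` the factor `d_j` occurs `∑_{s ≤ j} θ_s` times; the condition defining `T` says
  -- that `γ_j` completes this to `N`.
  have hN : (∏ s ∈ S, d s ^ γ s) * ∏ s ∈ S, c s ^ θ s = (∏ s ∈ S, d s) ^ N := by
    have : ∏ s ∈ S, c s ^ θ s = ∏ s ∈ S, ∏ j ∈ S with s ≤ j, d j ^ θ s :=
      Finset.prod_congr rfl fun s hs ↦ by rw [hcs s hs, ← Finset.prod_pow]
    rw [this, Finset.prod_comm' (t' := S) (s' := fun j ↦ {s ∈ S | s ≤ j}) (by grind),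
      ← Finset.prod_pow, ← Finset.prod_mul_distrib]
    exact Finset.prod_congr rfl fun s hs ↦ by rw [Finset.prod_pow_eq_pow_sum, ← pow_add, hp s hs]
  have hZ (s : I) (n : ℕ) : (Z s ^ n).map ψ ≤ Ideal.span {ψ (c s ^ n)} := by
    rw [Ideal.map_pow, map_pow, ← Ideal.span_singleton_pow]
    exact Ideal.pow_right_mono (hψ s) n
  have hle : ((∏ s ∈ S, Z s ^ θ s) ⊓ Z k).map ψ ≤ Ideal.span {ψ ((∏ s ∈ S, c s ^ θ s) * K)} := by
    by_cases h0 : ∃ s ∈ S, θ s ≠ 0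
    · have hne : {s ∈ S | θ s ≠ 0}.Nonempty := h0.imp fun s hs ↦ Finset.mem_filter.mpr hs
      obtain ⟨s', hs', hmin⟩ : ∃ s' ∈ {s ∈ S | θ s ≠ 0}, ∀ s ∈ {s ∈ S | θ s ≠ 0}, s' ≤ s :=
        ⟨_, Finset.min'_mem _ hne, Finset.min'_le _⟩
      simp only [Finset.mem_filter] at hs' hmin
      rw [h₁ θ s' hs'.1 hs'.2 fun s hs h ↦ hmin s ⟨hs, h⟩, Ideal.map_mul, Ideal.map_mul,
        ← Ideal.mapHom_apply ψ (∏ _ ∈ _, _), map_prod]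
      simp only [Ideal.mapHom_apply]
      refine (Ideal.mul_mono (Ideal.mul_mono
        (Finset.prod_le_prod' fun s _ ↦ hZ s (θ s)) (hZ s' _)) (hψ k)).trans ?_
      rw [Ideal.prod_span_singleton, Ideal.span_singleton_mul_span_singleton,
        Ideal.span_singleton_mul_span_singleton, Ideal.span_singleton_le_span_singleton,
        ← map_prod, ← map_mul, ← map_mul]
      refine map_dvd ψ ?_
      have hprod : ∏ s ∈ S, c s ^ θ s =
          (∏ s ∈ S with s' < s, c s ^ θ s) * (c s' ^ (θ s' - 1) * c s') := by
        rw [← Finset.prod_filter_mul_prod_filter_not S (s' < ·), ← pow_succ,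
          Nat.sub_add_cancel (Nat.one_le_iff_ne_zero.mpr hs'.2)]
        congr 1
        refine Finset.prod_eq_single_of_mem s' (by simp [hs'.1]) fun s hs h ↦ ?_
        simp only [Finset.mem_filter, not_lt] at hs
        have : θ s = 0 := by_contra fun h' ↦ h (hs.2.antisymm (hmin s ⟨hs.1, h'⟩))
        rw [this, pow_zero]
      -- This is the gain: the `c_k = D * K` brought in by (a) is a multiple of `c_{s'} * K`, so it
      -- restores the lost factor `c_{s'}` and adds `K`.
      obtain ⟨w, hw⟩ : c s' ∣ ∏ s ∈ S, d s := by
        rw [hcs s' hs'.1]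
        exact Finset.prod_dvd_prod_of_subset _ _ _ (Finset.filter_subset _ _)
      refine ⟨w, ?_⟩
      change _ * c k = _
      rw [hprod, hck, hw]
      ring
    -- For `θ = 0` condition (a) says nothing, but the product of the `Z_s` is the unit ideal and
    -- `K` divides `c_k`.
    · push Not at h0
      refine (Ideal.map_mono inf_le_right).trans ((hψ k).trans ?_)
      rw [Ideal.span_singleton_le_span_singleton]
      refine map_dvd ψ ?_
      rw [Finset.prod_congr rfl fun s hs ↦ by rw [h0 s hs, pow_zero], Finset.prod_const_one, one_mul]
      exact Dvd.intro_left _ hck.symm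
  rw [Ideal.map_mul]
  refine (Ideal.mul_mono_right hle).trans ?_
  simp only [Ideal.span_singleton_pow, Ideal.prod_span_singleton, Ideal.map_span,
    Set.image_singleton, Ideal.span_singleton_mul_span_singleton]
  rw [← map_mul, ← mul_assoc, hN]

/-- A numerator of `b` over `D ^ N` lies in `numerators` and, by `hb`, in `Z k`. Its image is
therefore divisible by that of `D ^ N * K`, and `D ^ N` cancels in `C`. -/
lemma dvd_of_forall_mem
    (h : IsDilatation φ (fun s : S ↦ Z s) (fun s : S ↦ ∏ j : S with s ≤ j, d j))
    {k : I} (hk : k ∉ S) (hSK : ∀ k ∉ S, ∀ s ∈ S, k < s)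
    (h₁ : ∀ (θ : I → ℕ), ∀ s' ∈ S, θ s' ≠ 0 → (∀ s ∈ S, θ s ≠ 0 → s' ≤ s) →
      (∏ s ∈ S, Z s ^ θ s) ⊓ Z k =
        (∏ s ∈ S with s' < s, Z s ^ θ s) * Z s' ^ (θ s' - 1) * Z k)
    (h₂ : ∀ (E : Type) (θ γ : E → I → ℕ),
      (⨆ e, (∏ s ∈ S, Ideal.span {d s} ^ γ e s) * ∏ s ∈ S, Z s ^ θ e s) ⊓ Z k =
        ⨆ e, (∏ s ∈ S, Ideal.span {d s} ^ γ e s) * ((∏ s ∈ S, Z s ^ θ e s) ⊓ Z k))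
    {χ : B →+* C} (hχ : ∀ i, ∀ m ∈ Z i, χ (φ (∏ j with i ≤ j, d j)) ∣ χ (φ m))
    (hd : ∀ i, χ (φ (d i)) ∈ nonZeroDivisors C) {b : B}
    (hb : ∀ N, ∀ x, φ (∏ s ∈ S, d s) ^ N * b = φ x → x ∈ Z k) :
    χ (φ (∏ j ∈ Sᶜ with k ≤ j, d j)) ∣ χ b := by
  obtain ⟨N, x, hx, e⟩ := exists_mem_numerators h b
  have key := map_numerators_inf_le hk hSK h₁ h₂ (ψ := χ.comp φ)
    (fun i ↦ Ideal.map_le_iff_le_comap.mpr fun m hm ↦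
      Ideal.mem_span_singleton.mpr (hχ i m hm)) N
    (Ideal.mem_map_of_mem _ ⟨hx, hb N x e⟩)
  rw [Ideal.mem_span_singleton, RingHom.comp_apply, RingHom.comp_apply, ← e, map_mul, map_mul,
    map_mul, map_pow, map_pow] at key
  have hD : χ (φ (∏ s ∈ S, d s)) ^ N ∈ nonZeroDivisors C := by
    rw [map_prod, map_prod]
    exact pow_mem (prod_mem fun s _ ↦ hd s) N
  obtain ⟨w, hw⟩ := key
  exact ⟨w, (mul_cancel_left_mem_nonZeroDivisors hD).mp (hw.trans (mul_assoc _ _ _))⟩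

end Panel

end AlgebraicGeometry

/-! ### Pullbacks of ideal sheaves and Cartier divisors. -/

namespace AlgebraicGeometry.Scheme.IdealSheafData

variable {X Y : Scheme.{u}}

lemma exists_affineOpens_le {x : X} {W : X.Opens} (hx : x ∈ W) :
    ∃ V : X.affineOpens, x ∈ V.1 ∧ V.1 ≤ W := by
  obtain ⟨_, ⟨V, hV, rfl⟩, hxV, hVW⟩ := X.isBasis_affineOpens.exists_subset_of_mem_open hx W.isOpen
  exact ⟨⟨V, hV⟩, hxV, hVW⟩

lemma image_le_of_le_preimage (j : X ⟶ Y) [IsOpenImmersion j] {U : Y.Opens} {V : X.Opens}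
    (h : V ≤ j ⁻¹ᵁ U) : j ''ᵁ V ≤ U := by
  rintro _ ⟨y, hy, rfl⟩
  exact h hy

lemma ideal_comap_of_isOpenImmersion' (K : Y.IdealSheafData) (j : X ⟶ Y) [IsOpenImmersion j]
    (U : Y.affineOpens) (V : X.affineOpens) (h : V.1 ≤ j ⁻¹ᵁ U.1) :
    (K.comap j).ideal V = (K.ideal U).map (j.appLE U.1 V.1 h).hom := by
  have h' : (⟨j ''ᵁ V.1, V.2.image_of_isOpenImmersion j⟩ : Y.affineOpens) ≤ U :=
    image_le_of_le_preimage j h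
  rw [ideal_comap_of_isOpenImmersion, ← K.map_ideal h']
  refine (Ideal.comap_symm (j.appIso V.1).commRingCatIsoToRingEquiv).trans ?_
  refine (Ideal.map_map _ (j.appIso V.1).hom.hom).trans ?_
  rw [← CommRingCat.hom_comp, Scheme.Hom.appIso_hom', Scheme.Hom.map_appLE]

/-- Pullback of ideal sheaves on sections over affine opens. -/
lemma ideal_comap (K : Y.IdealSheafData) (f : X ⟶ Y) (U : Y.affineOpens) (V : X.affineOpens)
    (h : V.1 ≤ f ⁻¹ᵁ U.1) : (K.comap f).ideal V = (K.ideal U).map (f.appLE U.1 V.1 h).hom := by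
  have : IsAffine V.1 := V.2
  have : IsAffine U.1 := U.2
  let g : V.1.toScheme ⟶ U.1.toScheme := f.resLE U.1 V.1 h
  have hV : (⊤ : V.1.toScheme.Opens) ≤ V.1.ι ⁻¹ᵁ V.1 := by simp
  have hU : (⊤ : U.1.toScheme.Opens) ≤ U.1.ι ⁻¹ᵁ U.1 := by simp
  have e : (K.comap f).comap V.1.ι = (K.comap U.1.ι).comap g := by
    rw [← comap_comp, ← comap_comp, Scheme.Hom.resLE_comp_ι]
  have e' := ideal_comap_of_isAffine (K.comap U.1.ι) g
  rw [← e, ideal_comap_of_isOpenImmersion' _ V.1.ι V ⟨⊤, isAffineOpen_top _⟩ hV,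
    ideal_comap_of_isOpenImmersion' _ U.1.ι U ⟨⊤, isAffineOpen_top _⟩ hU, Ideal.map_map] at e'
  have e'' : U.1.ι.appLE U.1 ⊤ hU ≫ g.appTop = f.appLE U.1 V.1 h ≫ V.1.ι.appLE V.1 ⊤ hV := by
    have : g.appTop = g.appLE ⊤ ⊤ le_top := Scheme.Hom.app_eq_appLE _
    have hg : g ≫ U.1.ι = V.1.ι ≫ f := Scheme.Hom.resLE_comp_ι ..
    refine (congr(_ ≫ $this)).trans ((Scheme.Hom.appLE_comp_appLE ..).trans
      (Eq.trans ?_ (Scheme.Hom.appLE_comp_appLE ..).symm))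
    simp only [hg]
  -- The affine case yields the claim only after extension to the global sections of `V`. Extension
  -- along a bijection can be undone by contraction.
  have hα : Function.Bijective (V.1.ι.appLE V.1 ⊤ hV).hom := by
    have : IsIso (V.1.ι.appLE V.1 ⊤ hV) := by
      rw [Scheme.Opens.ι_appLE]
      have h : V.1.ι ''ᵁ ⊤ = V.1 := by simp
      exact inferInstanceAs (IsIso (X.presheaf.map (eqToHom h).op))
    exact ConcreteCategory.bijective_of_isIso (V.1.ι.appLE V.1 ⊤ hV)
  rw [← CommRingCat.hom_comp, e'', CommRingCat.hom_comp, ← Ideal.map_map] at e'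
  have e := congr(Ideal.comap (V.1.ι.appLE V.1 ⊤ hV).hom $e')
  rwa [Ideal.comap_map_of_bijective _ hα, Ideal.comap_map_of_bijective _ hα] at e

lemma ideal_comap_eq_span (K : Y.IdealSheafData) (f : X ⟶ Y) {U : Y.affineOpens}
    {V : X.affineOpens} (h : V.1 ≤ f ⁻¹ᵁ U.1) {a : Γ(Y, U)} (ha : K.ideal U = Ideal.span {a}) :
    (K.comap f).ideal V = Ideal.span {f.appLE U.1 V.1 h a} := by
  rw [ideal_comap K f U V h, ha, Ideal.map_span, Set.image_singleton]

lemma ideal_comap_of_isAffineHom (K : Y.IdealSheafData) (f : X ⟶ Y) [IsAffineHom f]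
    (U : Y.affineOpens) :
    (K.comap f).ideal ⟨f ⁻¹ᵁ U.1, U.2.preimage f⟩ = (K.ideal U).map (f.app U.1).hom := by
  rw [ideal_comap K f U ⟨f ⁻¹ᵁ U.1, U.2.preimage f⟩ le_rfl, Scheme.Hom.app_eq_appLE]

lemma ideal_comap_eq_span_of_isAffineHom (K : Y.IdealSheafData) (f : X ⟶ Y) [IsAffineHom f]
    {U : Y.affineOpens} {a : Γ(Y, U)} (ha : K.ideal U = Ideal.span {a}) :
    (K.comap f).ideal ⟨f ⁻¹ᵁ U.1, U.2.preimage f⟩ = Ideal.span {f.app U.1 a} := by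
  rw [ideal_comap_of_isAffineHom, ha, Ideal.map_span, Set.image_singleton]

/-- Inclusions of ideal sheaves can be checked on affine opens mapping into small affine opens. -/
lemma le_of_forall_exists {J K : X.IdealSheafData}
    (H : ∀ x : X, ∃ V : X.affineOpens, x ∈ V.1 ∧ J.ideal V ≤ K.ideal V) : J ≤ K := by
  choose V hV hle using H
  exact le_of_iSup_eq_top V (top_le_iff.mp fun x _ ↦
    TopologicalSpace.Opens.mem_iSup.mpr ⟨x, hV x⟩) hle

lemma ext_of_forall_exists {J K : X.IdealSheafData}
    (H : ∀ x : X, ∃ V : X.affineOpens, x ∈ V.1 ∧ J.ideal V = K.ideal V) : J = K :=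
  (le_of_forall_exists fun x ↦ (H x).imp fun _ h ↦ ⟨h.1, h.2.le⟩).antisymm
    (le_of_forall_exists fun x ↦ (H x).imp fun _ h ↦ ⟨h.1, h.2.ge⟩)

lemma comap_mul (J K : Y.IdealSheafData) (f : X ⟶ Y) :
    (J * K).comap f = J.comap f * K.comap f := by
  refine ext_of_forall_exists fun x ↦ ?_
  obtain ⟨U, hxU, -⟩ := exists_affineOpens_le (show f x ∈ (⊤ : Y.Opens) from trivial)
  obtain ⟨V, hxV, h⟩ := exists_affineOpens_le (show x ∈ f ⁻¹ᵁ U.1 from hxU)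
  refine ⟨V, hxV, ?_⟩
  rw [ideal_mul, Pi.mul_apply, ideal_comap _ f U V h, ideal_comap _ f U V h,
    ideal_comap _ f U V h, ideal_mul, Pi.mul_apply, Ideal.map_mul]

lemma comap_prod {ι : Type*} (s : Finset ι) (J : ι → Y.IdealSheafData) (f : X ⟶ Y) :
    (∏ i ∈ s, J i).comap f = ∏ i ∈ s, (J i).comap f := by
  classical
  induction s using Finset.induction_on with
  | empty => simp
  | insert i s hi h => rw [Finset.prod_insert hi, Finset.prod_insert hi, comap_mul, h]

lemma ideal_prod {ι : Type*} (s : Finset ι) (J : ι → Y.IdealSheafData) (U : Y.affineOpens) :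
    (∏ i ∈ s, J i).ideal U = ∏ i ∈ s, (J i).ideal U := by
  classical
  induction s using Finset.induction_on with
  | empty => simp
  | insert i s hi h => rw [Finset.prod_insert hi, Finset.prod_insert hi, ideal_mul, Pi.mul_apply, h]

/-- Finitely many locally principal ideals are simultaneously principal on small affine opens. -/
lemma exists_forall_eq_span {ι : Type*} [Finite ι] (J : ι → X.IdealSheafData)
    (hJ : ∀ i, (J i).IsLocallyPrincipal) {x : X} {W : X.Opens} (hx : x ∈ W) :
    ∃ U : X.affineOpens, x ∈ U.1 ∧ U.1 ≤ W ∧ ∃ a : ι → Γ(X, U),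
      ∀ i, (J i).ideal U = Ideal.span {a i} := by
  choose U hU a ha using fun i ↦ hJ i x
  have : (⋂ i, ((U i).1 : Set X)) ∩ W ∈ nhds x :=
    Filter.inter_mem (Filter.iInter_mem.mpr fun i ↦ (U i).1.isOpen.mem_nhds (hU i))
      (W.isOpen.mem_nhds hx)
  obtain ⟨_, ⟨V, hV, rfl⟩, hxV, hVW⟩ := X.isBasis_affineOpens.mem_nhds_iff.mp this
  refine ⟨⟨V, hV⟩, hxV, fun y hy ↦ (hVW hy).2, fun i ↦ res (fun y hy ↦ ?_) (a i), fun i ↦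
    ideal_eq_span_of_le (V := ⟨V, hV⟩) _ (ha i)⟩
  exact Set.mem_iInter.mp (hVW hy).1 i

lemma res_basicOpen_mem_nonZeroDivisors {U : X.affineOpens} (f : Γ(X, U)) {V : X.Opens}
    (hV : V = X.basicOpen f) (h : V ≤ U) {a : Γ(X, U)} (ha : a ∈ nonZeroDivisors Γ(X, U)) :
    res h a ∈ nonZeroDivisors Γ(X, V) := by
  let := (res h).toAlgebra
  have : IsLocalization.Away f Γ(X, V) := U.2.isLocalization_of_eq_basicOpen f (homOfLE h) hV
  exact IsLocalization.map_nonZeroDivisors_le (.powers f) Γ(X, V) ⟨a, ha, rfl⟩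

lemma mem_nonZeroDivisors_of_span_eq {R : Type*} [CommRing R] {a b : R}
    (h : Ideal.span {a} = Ideal.span {b}) (ha : a ∈ nonZeroDivisors R) : b ∈ nonZeroDivisors R := by
  obtain ⟨c, rfl⟩ := Ideal.span_singleton_le_span_singleton.mp h.le
  exact (mul_mem_nonZeroDivisors.mp ha).1

/-- Regularity is checked on basic opens common to `U` and a Cartier chart, where `a` generates the
same ideal as a regular element. So equations may be chosen freely afterwards. -/
lemma IsCartier.mem_nonZeroDivisors {J : X.IdealSheafData} (hJ : J.IsCartier) {U : X.affineOpens}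
    {a : Γ(X, U)} (ha : J.ideal U = Ideal.span {a}) : a ∈ nonZeroDivisors Γ(X, U) := by
  refine mem_nonZeroDivisors_iff_right.mpr fun b hb ↦ ?_
  refine X.IsSheaf.section_ext fun x hx ↦ ?_
  obtain ⟨V, hxV, c, hc, hc'⟩ := hJ x
  obtain ⟨f, g, e, hxf⟩ := exists_basicOpen_le_affine_inter U.2 V.2 x ⟨hx, hxV⟩
  refine ⟨X.basicOpen f, X.basicOpen_le f, hxf, ?_⟩
  have h : X.basicOpen f ≤ V := e ▸ X.basicOpen_le g
  have h₁ := ideal_eq_span_of_le (V := X.affineBasicOpen f) (X.basicOpen_le f) ha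
  have h₂ := ideal_eq_span_of_le (V := X.affineBasicOpen f) h hc'
  have h₃ : res (X.basicOpen_le f) a ∈ nonZeroDivisors _ :=
    mem_nonZeroDivisors_of_span_eq (h₂.symm.trans h₁) (res_basicOpen_mem_nonZeroDivisors g e h hc)
  have h₄ := congr(res (X.basicOpen_le f) $hb)
  rw [map_mul, map_zero] at h₄
  exact (mem_nonZeroDivisors_iff_right.mp h₃ _ h₄).trans (map_zero _).symm

lemma IsCartier.isLocallyPrincipal {J : X.IdealSheafData} (hJ : J.IsCartier) :
    J.IsLocallyPrincipal := fun x ↦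
  (hJ x).imp fun _ h ↦ ⟨h.1, h.2.imp fun _ h' ↦ h'.2⟩

lemma IsCartier.appLE_mem_nonZeroDivisors {J : Y.IdealSheafData} {f : X ⟶ Y}
    (hJ : (J.comap f).IsCartier) {U : Y.affineOpens} {V : X.affineOpens} (h : V.1 ≤ f ⁻¹ᵁ U.1)
    {a : Γ(Y, U)} (ha : J.ideal U = Ideal.span {a}) :
    f.appLE U.1 V.1 h a ∈ nonZeroDivisors Γ(X, V) :=
  hJ.mem_nonZeroDivisors (ideal_comap_eq_span J f h ha)

lemma IsCartier.one : (1 : X.IdealSheafData).IsCartier := fun x ↦ by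
  obtain ⟨U, hU, -⟩ := exists_affineOpens_le (show x ∈ (⊤ : X.Opens) from trivial)
  exact ⟨U, hU, 1, one_mem _, by simp⟩

lemma IsCartier.mul {J K : X.IdealSheafData} (hJ : J.IsCartier) (hK : K.IsCartier) :
    (J * K).IsCartier := fun x ↦ by
  obtain ⟨U, hU, -, a, ha⟩ := exists_forall_eq_span (fun b : Bool ↦ if b then J else K)
    (by simp [hJ.isLocallyPrincipal, hK.isLocallyPrincipal]) (show x ∈ (⊤ : X.Opens) from trivial)
  have h₁ : J.ideal U = Ideal.span {a true} := by simpa using ha true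
  have h₂ : K.ideal U = Ideal.span {a false} := by simpa using ha false
  refine ⟨U, hU, _, mul_mem (hJ.mem_nonZeroDivisors h₁) (hK.mem_nonZeroDivisors h₂), ?_⟩
  rw [ideal_mul, Pi.mul_apply, h₁, h₂, Ideal.span_singleton_mul_span_singleton]

lemma IsCartier.prod {ι : Type*} (s : Finset ι) (J : ι → X.IdealSheafData)
    (h : ∀ i ∈ s, (J i).IsCartier) : (∏ i ∈ s, J i).IsCartier :=
  Finset.prod_induction _ _ (fun _ _ ↦ IsCartier.mul) .one h

/-- A divisor of a regular element is regular. This passes from the sums `∑_{j ≥ i} Dⱼ` back to the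
single `Dᵢ`. -/
lemma IsCartier.of_prod {ι : Type*} {s : Finset ι} {J : ι → X.IdealSheafData}
    (h : (∏ i ∈ s, J i).IsCartier) (hJ : ∀ i, (J i).IsLocallyPrincipal) {i : ι} (hi : i ∈ s) :
    (J i).IsCartier := fun x ↦ by
  obtain ⟨U, hU, -, a, ha⟩ := exists_forall_eq_span (fun i : s ↦ J i) (fun i ↦ hJ i)
    (show x ∈ (⊤ : X.Opens) from trivial)
  refine ⟨U, hU, a ⟨i, hi⟩, ?_, ha ⟨i, hi⟩⟩
  have := h.mem_nonZeroDivisors (U := U) (a := ∏ i ∈ s.attach, a i) (by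
    rw [ideal_prod, ← Finset.prod_attach, ← Ideal.prod_span_singleton]
    exact Finset.prod_congr rfl fun i _ ↦ ha i)
  obtain ⟨c, hc⟩ := Finset.dvd_prod_of_mem a (Finset.mem_attach s ⟨i, hi⟩)
  exact (mul_mem_nonZeroDivisors.mp (hc ▸ this)).1

lemma IsCartier.comap_of_isOpenImmersion {J : Y.IdealSheafData} (hJ : J.IsCartier)
    (j : X ⟶ Y) [IsOpenImmersion j] : (J.comap j).IsCartier := fun x ↦ by
  obtain ⟨U, hU, a, ha, e⟩ := hJ (j x)
  obtain ⟨V, hxV, h⟩ := exists_affineOpens_le (show x ∈ j ⁻¹ᵁ U.1 from hU)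
  have h' : (⟨j ''ᵁ V.1, V.2.image_of_isOpenImmersion j⟩ : Y.affineOpens) ≤ U :=
    image_le_of_le_preimage j h
  have h₁ := hJ.mem_nonZeroDivisors (ideal_eq_span_of_le h' e)
  refine ⟨V, hxV, (j.appIso V.1).hom (res h' a), ?_, ?_⟩
  · exact (MulEquivClass.map_nonZeroDivisors (j.appIso V.1).commRingCatIsoToRingEquiv).le
      ⟨_, h₁, rfl⟩
  · rw [ideal_comap_eq_span J j h e, Scheme.Hom.appIso_hom', ← Scheme.Hom.map_appLE (e := ?_)
      (i := (homOfLE h').op)]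
    rfl

end AlgebraicGeometry.Scheme.IdealSheafData

/-! ### The glued dilatation is a ring dilatation over each affine open with equations. -/

namespace AlgebraicGeometry

lemma IsDilatation.equiv_comp {A B B' ι : Type*} [CommRing A] [CommRing B] [CommRing B']
    {φ : A →+* B} {M : ι → Ideal A} {a : ι → A} (h : IsDilatation φ M a) (e : B ≃+* B') :
    IsDilatation (e.toRingHom.comp φ) M a where
  mem_nonZeroDivisors i := (MulEquivClass.map_nonZeroDivisors e).le
    ⟨_, h.mem_nonZeroDivisors i, rfl⟩
  torsion x hx := h.torsion x (e.injective (hx.trans (map_zero e).symm))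
  exists_fraction i m hm := by
    obtain ⟨g, hg⟩ := h.exists_fraction i m hm
    exact ⟨e g, (map_mul e _ _).symm.trans congr(e $hg)⟩
  closure_eq_top := by
    refine top_le_iff.mp fun b _ ↦ ?_
    have hb : e.symm b ∈ Subring.closure (Set.range φ ∪ {g | ∃ i, ∃ m ∈ M i, φ (a i) * g = φ m}) :=
      h.closure_eq_top ▸ trivial
    rw [← e.apply_symm_apply b]
    suffices _ ≤ (Subring.closure (Set.range (e.toRingHom.comp φ) ∪
      {g | ∃ i, ∃ m ∈ M i, (e.toRingHom.comp φ) (a i) * g = (e.toRingHom.comp φ) m})).comap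
        e.toRingHom from this hb
    rw [Subring.closure_le]
    rintro _ (⟨x, rfl⟩ | ⟨i, m, hm, hg⟩)
    · exact Subring.subset_closure (.inl ⟨x, rfl⟩)
    · exact Subring.subset_closure (.inr ⟨i, m, hm, (map_mul e _ _).symm.trans congr(e $hg)⟩)

lemma _root_.Subring.mk_mem_closure_preimage {R : Type*} [Ring R] {s : Set R} {x : R}
    (hx : x ∈ Subring.closure s) :
    (⟨x, hx⟩ : Subring.closure s) ∈ Subring.closure (Subtype.val ⁻¹' s) := by
  induction hx using Subring.closure_induction with
  | mem x hx => exact Subring.subset_closure hx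
  | zero => exact zero_mem _
  | one => exact one_mem _
  | add x y _ _ hx hy => exact add_mem hx hy
  | neg x _ hx => exact neg_mem hx
  | mul x y _ _ hx hy => exact mul_mem hx hy

lemma IsAffineOpen.appLE_SpecMap_comp_fromSpec {X : Scheme.{u}} {U : X.Opens} (hU : IsAffineOpen U)
    {R : CommRingCat.{u}} (γ : Γ(X, U) ⟶ R) (h : ⊤ ≤ (Spec.map γ ≫ hU.fromSpec) ⁻¹ᵁ U) :
    (Spec.map γ ≫ hU.fromSpec).appLE U ⊤ h = γ ≫ (Scheme.ΓSpecIso R).inv := by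
  have h' : ⊤ ≤ Spec.map γ ⁻¹ᵁ hU.fromSpec ⁻¹ᵁ U := h
  refine (Scheme.Hom.comp_appLE _ _ _ _ h).trans ?_
  change _ ≫ (Spec.map γ).appLE _ _ h' = _
  rw [IsAffineOpen.fromSpec_app_self, Category.assoc,
    Scheme.Hom.map_appLE, Scheme.ΓSpecIso_inv_naturality]
  congr 1

namespace Scheme.MultiCenter

variable {X : Scheme.{u}} {I : Type v} [Fintype I] (C : X.MultiCenter I)

/-- `π : B ⟶ X` is a dilatation of `X` with multi-center `C`. -/
structure IsDilatation {B : Scheme.{u}} (π : B ⟶ X) : Prop where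
  isAffineHom : IsAffineHom π
  isDilatation_app : ∀ (U : X.affineOpens) (a : I → Γ(X, U)),
    (∀ i, (C.divisor i).ideal U = Ideal.span {a i}) →
      AlgebraicGeometry.IsDilatation (π.app U.1).hom (fun i ↦ (C.center i).ideal U) a

variable {C}

lemma inf_away_eq_basicOpen {U : X.affineOpens} {a : I → Γ(X, U)}
    (ha : ∀ i, (C.divisor i).ideal U = Ideal.span {a i}) :
    U.1 ⊓ C.away = X.basicOpen (∏ i, a i) := by
  have e : (∏ i, C.divisor i).ideal U = Ideal.span {∏ i, a i} := by
    rw [IdealSheafData.ideal_prod, ← Ideal.prod_span_singleton]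
    exact Finset.prod_congr rfl fun i _ ↦ ha i
  ext x
  have hx (hxU : x ∈ U.1) : x ∈ C.away ↔ x ∈ X.basicOpen (∏ i, a i) := by
    have : x ∈ C.away ↔ ¬ x ∈ (∏ i, C.divisor i).support := Iff.rfl
    rw [this, IdealSheafData.mem_support_iff_of_mem hxU, e, zeroLocus_span, mem_zeroLocus_iff]
    simp
  exact ⟨fun h ↦ (hx h.1).mp h.2, fun h ↦ ⟨X.basicOpen_le _ h, (hx (X.basicOpen_le _ h)).mpr h⟩⟩

/-- Over `U` the complement of the divisors is the basic open of `∏ i, a i`, so the ambient ring is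
a localization in which every `a i` is a unit. Regularity, torsion and existence of fractions follow
from this. -/
lemma isDilatation_dilatationRing {U : X.affineOpens} {a : I → Γ(X, U)}
    (ha : ∀ i, (C.divisor i).ideal U = Ideal.span {a i}) :
    AlgebraicGeometry.IsDilatation ((res inf_le_left : Γ(X, U) →+* Γ(X, U.1 ⊓ C.away)).codRestrict
      (C.dilatationRing U) fun x ↦ Subring.subset_closure (.inl ⟨x, rfl⟩))
      (fun i ↦ (C.center i).ideal U) a := by
  let ρ : Γ(X, U) →+* Γ(X, U.1 ⊓ C.away) := res inf_le_left
  let := ρ.toAlgebra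
  have hloc : IsLocalization.Away (∏ i, a i) Γ(X, U.1 ⊓ C.away) :=
    U.2.isLocalization_of_eq_basicOpen _ (homOfLE inf_le_left) (inf_away_eq_basicOpen ha)
  have hunit (i : I) : IsUnit (ρ (a i)) := by
    have : IsUnit (ρ (∏ i, a i)) := IsLocalization.Away.algebraMap_isUnit _
    rw [map_prod, IsUnit.prod_univ_iff] at this
    exact this i
  have hfrac (i : I) (g : Γ(X, U.1 ⊓ C.away)) : g ∈ C.fractions U i ↔
      ∃ m ∈ (C.center i).ideal U, ρ (a i) * g = ρ m := by
    rw [C.fractions_eq U i (ha i)]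
    rfl
  have hmem (i : I) {g : Γ(X, U.1 ⊓ C.away)} (hg : g ∈ C.fractions U i) :
      g ∈ C.dilatationRing U :=
    Subring.subset_closure (.inr (Set.mem_iUnion.mpr ⟨i, hg⟩))
  refine ⟨fun i ↦ ?_, fun x hx ↦ ?_, fun i m hm ↦ ?_, ?_⟩
  · refine mem_nonZeroDivisors_iff_right.mpr fun b hb ↦ Subtype.ext ?_
    exact (hunit i).mul_left_eq_zero.mp congr(($hb).1)
  · obtain ⟨⟨_, n, rfl⟩, hn⟩ := (IsLocalization.map_eq_zero_iff
      (Submonoid.powers (∏ i, a i))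
      Γ(X, U.1 ⊓ C.away) x).mp congr(($hx).1)
    exact ⟨_, pow_mem (prod_mem fun i _ ↦ Submonoid.subset_closure (Set.mem_range_self i)) n, hn⟩
  · obtain ⟨g, hg⟩ := (hunit i).dvd (a := ρ m)
    exact ⟨⟨g, hmem i ((hfrac i g).mpr ⟨m, hm, hg.symm⟩)⟩, Subtype.ext hg.symm⟩
  · refine top_le_iff.mp fun g _ ↦ Subring.closure_mono ?_ (Subring.mk_mem_closure_preimage g.2)
    rintro ⟨g, hg⟩ (⟨x, rfl⟩ | h)
    · exact .inl ⟨x, rfl⟩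
    · obtain ⟨i, h⟩ := Set.mem_iUnion.mp h
      obtain ⟨m, hm, e⟩ := (hfrac i g).mp h
      exact .inr ⟨i, m, hm, Subtype.ext e⟩

theorem isDilatation_dilatation : C.IsDilatation C.dilatation.hom := by
  let D := AffineZariskiSite.relativeGluingData C.coequifibered_toDilatationPresheaf
  have : (D.functor ⋙ forget).IsLocallyDirected :=
    Cover.RelativeGluingData.instIsLocallyDirectedI₀CompFunctorForgetOfIsThin ..
  let j (U : X.AffineZariskiSite) : D.functor.obj U ⟶ C.dilatation.left := colimit.ι D.functor U
  have hj (U : X.AffineZariskiSite) : IsOpenImmersion (j U) :=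
    have {i j : X.AffineZariskiSite} (f : i ⟶ j) : IsOpenImmersion (D.functor.map f) :=
      D.instIsOpenImmersionMapI₀Functor f
    inferInstanceAs (IsOpenImmersion (colimit.ι D.functor U))
  have hpre (U : X.AffineZariskiSite) : C.dilatation.hom ⁻¹ᵁ U.1 = (j U).opensRange := by
    refine Eq.trans ?_ (D.toBase_preimage_eq_opensRange_ι U)
    exact congr(D.toBase ⁻¹ᵁ $((Opens.opensRange_ι U.1).symm))
  have haff (U : X.AffineZariskiSite) : IsAffineOpen (C.dilatation.hom ⁻¹ᵁ U.1) := by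
    rw [hpre]
    have : IsAffine (D.functor.obj U) := inferInstanceAs (IsAffine (Spec _))
    exact isAffineOpen_opensRange _
  refine ⟨⟨fun U hU ↦ haff ⟨U, hU⟩⟩, fun ⟨U, hU⟩ a ha ↦ ?_⟩
  let R : CommRingCat := .of (C.dilatationRing ⟨U, hU⟩)
  let γ : Γ(X, U) ⟶ R := C.toDilatationPresheaf.app (.op ⟨U, hU⟩)
  let k : Spec R ⟶ C.dilatation.left := j ⟨U, hU⟩
  have : IsOpenImmersion k := hj ⟨U, hU⟩
  have hk : k ≫ C.dilatation.hom = Spec.map γ ≫ hU.fromSpec := by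
    refine (D.ι_toBase (⟨U, hU⟩ : X.AffineZariskiSite)).trans ?_
    refine (Category.assoc _ _ _).trans ?_
    rfl
  have h : (⊤ : (Spec R).Opens) ≤ k ⁻¹ᵁ (C.dilatation.hom ⁻¹ᵁ U) := by
    rw [hpre ⟨U, hU⟩]
    rintro x -
    exact ⟨x, rfl⟩
  have hiso : IsIso (k.appLE _ _ h) := by
    have e : k ''ᵁ ⊤ = C.dilatation.hom ⁻¹ᵁ U := by
      rw [hpre ⟨U, hU⟩, Scheme.Hom.image_top_eq_opensRange]
      rfl
    rw [← Scheme.Hom.map_appLE (e := (k.preimage_image_eq ⊤).ge) (i := (eqToHom e).op), ← Scheme.Hom.appIso_hom']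
    infer_instance
  let e : R ≅ Γ(C.dilatation.left, C.dilatation.hom ⁻¹ᵁ U) :=
    (ΓSpecIso R).symm ≪≫ (asIso (k.appLE _ _ h)).symm
  -- Up to the isomorphism with the chart `Spec R`, the structure map on sections over `U` is the
  -- inclusion into `dilatationRing`, whose properties are already known.
  have key : C.dilatation.hom.app U = γ ≫ e.hom := by
    simp only [e, Iso.trans_hom, Iso.symm_hom, asIso_inv]
    rw [← Category.assoc, IsIso.eq_comp_inv]
    refine (Scheme.Hom.comp_appLE ..).symm.trans ?_
    have h' : (⊤ : (Spec R).Opens) ≤ (Spec.map γ ≫ hU.fromSpec) ⁻¹ᵁ U := hk ▸ h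
    have : (k ≫ C.dilatation.hom).appLE U ⊤ h = (Spec.map γ ≫ hU.fromSpec).appLE U ⊤ h' := by
      simp only [hk]
    exact this.trans (IsAffineOpen.appLE_SpecMap_comp_fromSpec hU γ h')
  rw [key]
  exact (isDilatation_dilatationRing ha).equiv_comp e.commRingCatIsoToRingEquiv

end Scheme.MultiCenter

end AlgebraicGeometry

/-! ### The universal property of dilatations of schemes. -/

namespace AlgebraicGeometry.Scheme.MultiCenter

variable {X : Scheme.{u}} {I : Type v} {C : X.MultiCenter I} {B : Scheme.{u}} {π : B ⟶ X}

open IdealSheafData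

/-- The condition on `f : T ⟶ X` to factor (uniquely) through the dilatation. -/
structure IsAdmissible (C : X.MultiCenter I) {T : Scheme.{u}} (f : T ⟶ X) : Prop where
  isCartier : ∀ i, ((C.divisor i).comap f).IsCartier
  comap_le : ∀ i, (C.center i).comap f ≤ (C.divisor i).comap f

lemma IsAdmissible.comp_of_isOpenImmersion {T T' : Scheme.{u}} {f : T ⟶ X} (hf : C.IsAdmissible f)
    (j : T' ⟶ T) [IsOpenImmersion j] : C.IsAdmissible (j ≫ f) where
  isCartier i := by
    rw [comap_comp]
    exact (hf.isCartier i).comap_of_isOpenImmersion j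
  comap_le i := by
    rw [comap_comp, comap_comp]
    exact comap_mono j (hf.comap_le i)

variable [Fintype I]

/-- Every point has a neighbourhood on which the divisors have equations. -/
lemma exists_equations (C : X.MultiCenter I) {x : X} {W : X.Opens} (hx : x ∈ W) :
    ∃ U : X.affineOpens, x ∈ U.1 ∧ U.1 ≤ W ∧ ∃ a : I → Γ(X, U),
      ∀ i, (C.divisor i).ideal U = Ideal.span {a i} :=
  exists_forall_eq_span C.divisor C.isLocallyPrincipal hx

namespace IsDilatation

/-- Needed for iterated dilatations: the `D_s` made Cartier by the first one must stay Cartier after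
the second. -/
lemma isCartier_comap_of_isCartier (h : C.IsDilatation π) {J : X.IdealSheafData}
    (hJ : J.IsCartier) : (J.comap π).IsCartier := fun x ↦ by
  obtain ⟨W, hxW, d, hd, e⟩ := hJ (π x)
  obtain ⟨U, hxU, hUW, a, ha⟩ := C.exists_equations hxW
  have e' := ideal_eq_span_of_le hUW e
  have := h.isAffineHom
  exact ⟨⟨π ⁻¹ᵁ U.1, U.2.preimage π⟩, hxU, π.app U.1 (res hUW d),
    (h.isDilatation_app U a ha).map_mem_nonZeroDivisors_of_mem (hJ.mem_nonZeroDivisors e'),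
    ideal_comap_eq_span_of_isAffineHom J π e'⟩

lemma isAdmissible (h : C.IsDilatation π) : C.IsAdmissible π where
  isCartier i x := by
    obtain ⟨U, hxU, -, a, ha⟩ := C.exists_equations (show π x ∈ (⊤ : X.Opens) from trivial)
    have := h.isAffineHom
    exact ⟨⟨π ⁻¹ᵁ U.1, U.2.preimage π⟩, hxU, π.app U.1 (a i),
      (h.isDilatation_app U a ha).mem_nonZeroDivisors i,
      ideal_comap_eq_span_of_isAffineHom _ π (ha i)⟩
  comap_le i := le_of_forall_exists fun x ↦ by
    obtain ⟨U, hxU, -, a, ha⟩ := C.exists_equations (show π x ∈ (⊤ : X.Opens) from trivial)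
    have := h.isAffineHom
    refine ⟨⟨π ⁻¹ᵁ U.1, U.2.preimage π⟩, hxU, ?_⟩
    rw [ideal_comap_eq_span_of_isAffineHom _ π (ha i), ideal_comap_of_isAffineHom,
      Ideal.map_le_iff_le_comap]
    intro m hm
    obtain ⟨g, hg⟩ := (h.isDilatation_app U a ha).exists_fraction i m hm
    exact Ideal.mem_span_singleton.mpr ⟨g, hg.symm⟩

lemma hom_ext (h : C.IsDilatation π) {T : Scheme.{u}} {g g' : T ⟶ B} (e : g ≫ π = g' ≫ π)
    (hC : ∀ i, ((C.divisor i).comap (g ≫ π)).IsCartier) : g = g' := by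
  have key (x : T) : ∃ V : T.affineOpens, x ∈ V.1 ∧ V.2.fromSpec ≫ g = V.2.fromSpec ≫ g' := by
    obtain ⟨U, hxU, -, a, ha⟩ := C.exists_equations (show (g ≫ π) x ∈ (⊤ : X.Opens) from trivial)
    obtain ⟨V, hxV, hV⟩ := exists_affineOpens_le (show x ∈ (g ≫ π) ⁻¹ᵁ U.1 from hxU)
    have := h.isAffineHom
    have hU : IsAffineOpen (π ⁻¹ᵁ U.1) := U.2.preimage π
    refine ⟨V, hxV, ?_⟩
    have hV₁ : V.1 ≤ g ⁻¹ᵁ π ⁻¹ᵁ U.1 := hV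
    have hV₂ : V.1 ≤ g' ⁻¹ᵁ π ⁻¹ᵁ U.1 := by rw [e] at hV; exact hV
    have e₁ : π.app U.1 ≫ g.appLE _ V.1 hV₁ = (g ≫ π).appLE U.1 V.1 hV :=
      (Scheme.Hom.comp_appLE g π U.1 V.1 hV).symm
    have e₂ : π.app U.1 ≫ g'.appLE _ V.1 hV₂ = (g ≫ π).appLE U.1 V.1 hV := by
      simp only [e]
      exact (Scheme.Hom.comp_appLE g' π U.1 V.1 _).symm
    rw [← IsAffineOpen.SpecMap_appLE_fromSpec g hU V.2 hV₁,
      ← IsAffineOpen.SpecMap_appLE_fromSpec g' hU V.2 hV₂]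
    congr 2
    refine CommRingCat.hom_ext ((h.isDilatation_app U a ha).hom_ext (fun i ↦ ?_) ?_)
    · have := (hC i).appLE_mem_nonZeroDivisors hV (ha i)
      rw [← e₁] at this
      exact this
    · exact congr(($(e₁.trans e₂.symm)).hom)
  choose V hxV hV using key
  let 𝒰 : T.OpenCover := T.openCoverOfIsOpenCover (fun x ↦ (V x).1)
    (.mk (top_le_iff.mp fun x _ ↦ TopologicalSpace.Opens.mem_iSup.mpr ⟨x, hxV x⟩))
  refine 𝒰.hom_ext _ _ fun x ↦ ?_
  change (V x).1.ι ≫ g = (V x).1.ι ≫ g'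
  rw [← cancel_epi (V x).2.isoSpec.inv]
  exact hV x

lemma exists_local_lift (h : C.IsDilatation π) {T : Scheme.{u}} {f : T ⟶ X}
    (hf : C.IsAdmissible f) (x : T) :
    ∃ V : T.affineOpens, x ∈ V.1 ∧ ∃ g : V.1.toScheme ⟶ B, g ≫ π = V.1.ι ≫ f := by
  obtain ⟨U, hxU, -, a, ha⟩ := C.exists_equations (show f x ∈ (⊤ : X.Opens) from trivial)
  obtain ⟨V, hxV, hV⟩ := exists_affineOpens_le (show x ∈ f ⁻¹ᵁ U.1 from hxU)
  obtain ⟨χ, hχ⟩ := (h.isDilatation_app U a ha).exists_lift (ψ := (f.appLE U.1 V.1 hV).hom)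
    (fun i ↦ (hf.isCartier i).appLE_mem_nonZeroDivisors hV (ha i)) (fun i m hm ↦ by
      have := hf.comap_le i V
      rw [ideal_comap_eq_span _ f hV (ha i), ideal_comap _ f U V hV,
        Ideal.map_le_iff_le_comap] at this
      exact Ideal.mem_span_singleton.mp (this hm))
  have := h.isAffineHom
  have hU : IsAffineOpen (π ⁻¹ᵁ U.1) := U.2.preimage π
  have hVa : IsAffineOpen V.1 := V.2
  refine ⟨V, hxV, hVa.isoSpec.hom ≫ Spec.map (CommRingCat.ofHom χ) ≫ hU.fromSpec, ?_⟩
  have e : π.app U.1 ≫ CommRingCat.ofHom χ = f.appLE U.1 V.1 hV := CommRingCat.hom_ext hχ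
  have e' : Spec.map (CommRingCat.ofHom χ) ≫ hU.fromSpec ≫ π = hVa.fromSpec ≫ f := by
    rw [← IsAffineOpen.SpecMap_appLE_fromSpec π U.2 hU le_rfl, ← Scheme.Hom.app_eq_appLE,
      ← Spec.map_comp_assoc, e, IsAffineOpen.SpecMap_appLE_fromSpec f U.2 hVa hV]
  rw [Category.assoc, Category.assoc, e', ← Category.assoc]
  congr 1
  rw [IsAffineOpen.fromSpec, Iso.hom_inv_id_assoc]

theorem exists_lift (h : C.IsDilatation π) {T : Scheme.{u}} {f : T ⟶ X}
    (hf : C.IsAdmissible f) : ∃ g : T ⟶ B, g ≫ π = f := by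
  choose V hxV g hg using h.exists_local_lift hf
  let 𝒰 : T.OpenCover := T.openCoverOfIsOpenCover (fun x ↦ (V x).1)
    (.mk (top_le_iff.mp fun x _ ↦ TopologicalSpace.Opens.mem_iSup.mpr ⟨x, hxV x⟩))
  let γ (x : 𝒰.I₀) : 𝒰.X x ⟶ B := g x
  have hγ (x : 𝒰.I₀) : γ x ≫ π = 𝒰.f x ≫ f := hg x
  -- Local lifts agree on overlaps by uniqueness, which applies because an overlap is open in `T`
  -- and the divisors remain Cartier on it.
  refine ⟨𝒰.glueMorphisms γ fun x y ↦ h.hom_ext ?_ fun i ↦ ?_, ?_⟩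
  · rw [Category.assoc, Category.assoc, hγ, hγ, pullback.condition_assoc]
  · have := (hf.comp_of_isOpenImmersion (pullback.fst (𝒰.f x) (𝒰.f y) ≫ 𝒰.f x)).isCartier i
    rwa [Category.assoc, ← hγ, ← Category.assoc] at this
  · refine 𝒰.hom_ext _ _ fun x ↦ ?_
    rw [← Category.assoc, Cover.ι_glueMorphisms, hγ]

end IsDilatation

end AlgebraicGeometry.Scheme.MultiCenter

/-! ### Dilatations of closed subschemes inside dilatations. -/

namespace AlgebraicGeometry.Scheme

open IdealSheafData

lemma IdealSheafData.comap_map_of_isClosedImmersion {X Y : Scheme.{u}} (i : Y ⟶ X)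
    [IsClosedImmersion i] (J : Y.IdealSheafData) : (J.map i).comap i = J := by
  refine (comap_map_le _ _).antisymm (le_of_forall_exists fun x ↦ ?_)
  obtain ⟨U, hxU, -⟩ := exists_affineOpens_le (show i x ∈ (⊤ : X.Opens) from trivial)
  refine ⟨⟨i ⁻¹ᵁ U.1, U.2.preimage i⟩, hxU, ?_⟩
  rw [ideal_comap_of_isAffineHom, ideal_map_of_isAffineHom,
    Ideal.map_comap_of_surjective _ (i.app_surjective U.1 U.2)]

lemma IdealSheafData.ker_inclusion {X : Scheme.{u}} {J K : X.IdealSheafData} (h : J ≤ K) :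
    (inclusion h).ker = K.comap J.subschemeι := by
  rw [← comap_map_of_isClosedImmersion J.subschemeι (inclusion h).ker, map_ker,
    inclusion_subschemeι, ker_subschemeι]

lemma isClosedImmersion_of_forall_exists {Y B : Scheme.{u}} (F : Y ⟶ B)
    (H : ∀ x : B, ∃ V : B.affineOpens, x ∈ V.1 ∧ IsAffineOpen (F ⁻¹ᵁ V.1) ∧
      Function.Surjective (F.app V.1)) : IsClosedImmersion F := by
  choose V hV haff hsurj using H
  refine (IsZariskiLocalAtTarget.iff_of_iSup_eq_top (P := @IsClosedImmersion) (fun x ↦ (V x).1)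
    (top_le_iff.mp fun x _ ↦ TopologicalSpace.Opens.mem_iSup.mpr ⟨x, hV x⟩)).mpr fun x ↦ ?_
  have : IsAffine (V x).1 := (V x).2
  have : IsAffine (F ⁻¹ᵁ (V x).1) := haff x
  refine IsClosedImmersion.of_surjective_of_isAffine _ ?_
  have hs : Function.Surjective (F.app ((V x).1.ι ''ᵁ ⊤)) :=
    (V x).1.ι_image_top.symm ▸ hsurj x
  rw [morphismRestrict_appTop]
  exact (ConcreteCategory.bijective_of_isIso (Y.presheaf.map
    (eqToHom (image_morphismRestrict_preimage F (V x).1 ⊤)).op)).2.comp hs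

namespace MultiCenter

variable {X Y : Scheme.{u}} {I : Type v}

/-- The pullback of a multi-center. -/
@[simps]
noncomputable def comap (C : X.MultiCenter I) (i : Y ⟶ X) : Y.MultiCenter I where
  center j := (C.center j).comap i
  divisor j := (C.divisor j).comap i
  isLocallyPrincipal j := (C.isLocallyPrincipal j).comap i

lemma isAdmissible_comap_iff {C : X.MultiCenter I} {i : Y ⟶ X} {T : Scheme.{u}} {f : T ⟶ Y} :
    (C.comap i).IsAdmissible f ↔ C.IsAdmissible (f ≫ i) := by
  refine ⟨fun h ↦ ⟨fun j ↦ ?_, fun j ↦ ?_⟩, fun h ↦ ⟨fun j ↦ ?_, fun j ↦ ?_⟩⟩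
  · simpa using h.isCartier j
  · simpa using h.comap_le j
  · simpa using h.isCartier j
  · simpa using h.comap_le j

variable {C : X.MultiCenter I} {B B' : Scheme.{u}} {π : B ⟶ X} {i : Y ⟶ X}
  {π' : B' ⟶ Y} {F : B' ⟶ B}

lemma IsDilatation.isDilatation_comap_app [IsAffineHom i]
    (h' : (C.comap i).IsDilatation π') (U : X.affineOpens) (a : I → Γ(X, U))
    (ha : ∀ j, (C.divisor j).ideal U = Ideal.span {a j}) :
    AlgebraicGeometry.IsDilatation (π'.app (i ⁻¹ᵁ U.1)).hom
      (fun j ↦ ((C.center j).ideal U).map (i.app U.1).hom) (fun j ↦ i.app U.1 (a j)) := by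
  have := h'.isDilatation_app ⟨i ⁻¹ᵁ U.1, U.2.preimage i⟩ (fun j ↦ i.app U.1 (a j))
    fun j ↦ ideal_comap_eq_span_of_isAffineHom _ i (ha j)
  simpa only [comap_center, ideal_comap_of_isAffineHom] using this

variable [Fintype I]

lemma IsDilatation.exists_hom {P T : Over X} (h : C.IsDilatation P.hom)
    (hT : C.IsAdmissible T.hom) : ∃ g : T ⟶ P, ∀ g', g' = g := by
  obtain ⟨g, hg⟩ := h.exists_lift hT
  refine ⟨Over.homMk g hg, fun g' ↦ ?_⟩
  ext
  refine h.hom_ext ((Over.w g').trans hg.symm) fun i ↦ ?_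
  have := hT.isCartier i
  rw [← Over.w g'] at this
  exact this

/-- The morphism of affine sections induced by a morphism of dilatations. -/
lemma app_comp_appLE (w : F ≫ π = π' ≫ i) (U : X.Opens) (h : π' ⁻¹ᵁ i ⁻¹ᵁ U ≤ F ⁻¹ᵁ π ⁻¹ᵁ U) :
    π.app U ≫ F.appLE (π ⁻¹ᵁ U) (π' ⁻¹ᵁ i ⁻¹ᵁ U) h = i.app U ≫ π'.app (i ⁻¹ᵁ U) := by
  have h' : π' ⁻¹ᵁ i ⁻¹ᵁ U ≤ (F ≫ π) ⁻¹ᵁ U := h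
  refine (Scheme.Hom.comp_appLE F π U _ h').symm.trans ?_
  simp only [w]
  exact (Scheme.Hom.app_eq_appLE _).symm

lemma preimage_eq (w : F ≫ π = π' ≫ i) (U : X.Opens) : π' ⁻¹ᵁ i ⁻¹ᵁ U = F ⁻¹ᵁ π ⁻¹ᵁ U :=
  congr($w.symm ⁻¹ᵁ U)

lemma mem_ker_app_iff (w : F ≫ π = π' ≫ i) (U : X.Opens) (b : Γ(B, π ⁻¹ᵁ U)) :
    b ∈ RingHom.ker (F.app (π ⁻¹ᵁ U)).hom ↔
      F.appLE (π ⁻¹ᵁ U) (π' ⁻¹ᵁ i ⁻¹ᵁ U) (preimage_eq w U).le b = 0 := by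
  rw [Scheme.Hom.appLE, CommRingCat.comp_apply, RingHom.mem_ker]
  exact (map_eq_zero_iff _ (ConcreteCategory.bijective_of_isIso
    (B'.presheaf.map (eqToHom (preimage_eq w U)).op)).1).symm

lemma isClosedImmersion_of_comap [IsClosedImmersion i] (h : C.IsDilatation π)
    (h' : (C.comap i).IsDilatation π') (w : F ≫ π = π' ≫ i) : IsClosedImmersion F := by
  have := h.isAffineHom
  have := h'.isAffineHom
  refine isClosedImmersion_of_forall_exists F fun x ↦ ?_
  obtain ⟨U, hxU, -, a, ha⟩ := C.exists_equations (show π x ∈ (⊤ : X.Opens) from trivial)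
  refine ⟨⟨π ⁻¹ᵁ U.1, U.2.preimage π⟩, hxU, ?_, ?_⟩
  · exact preimage_eq w U.1 ▸ (U.2.preimage i).preimage π'
  · have e := app_comp_appLE w U.1 (preimage_eq w U.1).le
    have := (h.isDilatation_app U a ha).surjective (i.app_surjective U.1 U.2)
      (h'.isDilatation_comap_app U a ha) (congr(($e).hom))
    intro y
    let ρ := B'.presheaf.map (eqToHom (preimage_eq w U.1)).op
    obtain ⟨b, hb⟩ := this (ρ y)
    exact ⟨b, (ConcreteCategory.bijective_of_isIso ρ).1 hb⟩

/-- A section `m` vanishing on `Y` lies in the center with index `j`, so `m = a_j * g` on `B`. On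
`B'` the product is zero while `a_j` is regular, so the quotient `g` vanishes on `B'`. -/
lemma comap_ker_le_mul_ker [IsClosedImmersion i] (h : C.IsDilatation π)
    (h' : (C.comap i).IsDilatation π') (w : F ≫ π = π' ≫ i) {j : I} (hj : i.ker ≤ C.center j) :
    i.ker.comap π ≤ (C.divisor j).comap π * F.ker := by
  have := isClosedImmersion_of_comap h h' w
  have := h.isAffineHom
  refine le_of_forall_exists fun x ↦ ?_
  obtain ⟨U, hxU, -, a, ha⟩ := C.exists_equations (show π x ∈ (⊤ : X.Opens) from trivial)
  refine ⟨⟨π ⁻¹ᵁ U.1, U.2.preimage π⟩, hxU, ?_⟩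
  rw [ideal_comap_of_isAffineHom, ideal_mul, Pi.mul_apply,
    ideal_comap_eq_span_of_isAffineHom _ π (ha j), Ideal.map_le_iff_le_comap, Hom.ker_apply F]
  intro m hm
  obtain ⟨g, hg⟩ := (h.isDilatation_app U a ha).exists_fraction j m (hj U hm)
  rw [Ideal.mem_comap, ← hg]
  refine Ideal.mul_mem_mul (Ideal.mem_span_singleton_self _) ((mem_ker_app_iff w U.1 g).mpr ?_)
  have e (y : Γ(X, U)) : F.appLE _ _ (preimage_eq w U.1).le (π.app U.1 y) =
      π'.app (i ⁻¹ᵁ U.1) (i.app U.1 y) :=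
    congr($(app_comp_appLE w U.1 (preimage_eq w U.1).le) y)
  have e₁ := congr(F.appLE _ _ (preimage_eq w U.1).le $hg)
  erw [map_mul, e, e] at e₁
  rw [Hom.ker_apply i, RingHom.mem_ker] at hm
  erw [hm, map_zero] at e₁
  exact (mul_left_mem_nonZeroDivisors_eq_zero_iff
    ((h'.isDilatation_comap_app U a ha).mem_nonZeroDivisors j)).mp e₁

end MultiCenter

end AlgebraicGeometry.Scheme

/-! ### Deformation spaces, inner spaces and the ideals of the latter. -/

namespace AlgebraicGeometry.Scheme

open IdealSheafData

section

variable {X : Scheme.{u}} {I : Type v} [LinearOrder I] [Fintype I]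

/-- The multi-center of the dilatation `deformationSpace Z D hD`. -/
@[simps]
noncomputable def deformationCenter (Z D : I → X.IdealSheafData)
    (hD : ∀ i, (D i).IsLocallyPrincipal) : X.MultiCenter I where
  center := Z
  divisor i := ∏ j with i ≤ j, D j
  isLocallyPrincipal _ := .prod _ _ fun j _ ↦ hD j

variable {Z D : I → X.IdealSheafData} {hD : ∀ i, (D i).IsLocallyPrincipal}

lemma isDilatation_deformationSpace :
    (deformationCenter Z D hD).IsDilatation (deformationSpace Z D hD).hom :=
  MultiCenter.isDilatation_dilatation

lemma comap_deformationCenter {Y : Scheme.{u}} (f : Y ⟶ X) :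
    (deformationCenter Z D hD).comap f =
      deformationCenter (fun i ↦ (Z i).comap f) (fun i ↦ (D i).comap f) fun i ↦ (hD i).comap f := by
  simp only [MultiCenter.comap, deformationCenter, comap_prod]

lemma isAdmissible_deformationCenter_iff {T : Scheme.{u}} {f : T ⟶ X} :
    (deformationCenter Z D hD).IsAdmissible f ↔ (∀ i, ((D i).comap f).IsCartier) ∧
      ∀ i, (Z i).comap f ≤ ∏ j with i ≤ j, (D j).comap f := by
  refine ⟨fun h ↦ ⟨fun i ↦ ?_, fun i ↦ ?_⟩, fun h ↦ ⟨fun i ↦ ?_, fun i ↦ ?_⟩⟩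
  · have := h.isCartier i
    rw [deformationCenter_divisor, comap_prod] at this
    exact this.of_prod (fun j ↦ (hD j).comap f) (by simp)
  · simpa [comap_prod] using h.comap_le i
  · simpa [comap_prod] using IsCartier.prod _ _ fun i _ ↦ h.1 i
  · simpa [comap_prod] using h.2 i

lemma deformationSpace_hom_ext {T : Over X} {g g' : T ⟶ deformationSpace Z D hD}
    (h : ∀ i, ((D i).comap T.hom).IsCartier) : g = g' := by
  ext
  refine isDilatation_deformationSpace.hom_ext ((Over.w g).trans (Over.w g').symm) fun i ↦ ?_
  rw [Over.w g, deformationCenter_divisor, comap_prod]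
  exact .prod _ _ fun i _ ↦ h i

end

lemma IdealSheafData.IsCartier.app_mem_nonZeroDivisors {X Y : Scheme.{u}} {J : X.IdealSheafData}
    {i : Y ⟶ X} [IsAffineHom i] (hJ : (J.comap i).IsCartier) {U : X.affineOpens} {a : Γ(X, U)}
    (ha : J.ideal U = Ideal.span {a}) :
    (i.app U.1).hom a ∈ nonZeroDivisors Γ(Y, i ⁻¹ᵁ U.1) :=
  hJ.mem_nonZeroDivisors (ideal_comap_eq_span_of_isAffineHom J i ha)

namespace DeformationDatum

variable {X : Scheme.{u}} {I : Type v} [LinearOrder I] (𝒳 : X.DeformationDatum I)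
  (S : Finset I)

/-- The multi-center of `𝒳.outer S`. -/
noncomputable abbrev outerCenter : X.MultiCenter S :=
  deformationCenter (fun s : S ↦ 𝒳.Z s) (fun s ↦ 𝒳.D s) (fun s ↦ 𝒳.isLocallyPrincipal s)

lemma isDilatation_outer : (𝒳.outerCenter S).IsDilatation (𝒳.outer S).hom :=
  isDilatation_deformationSpace

lemma isDilatation_inner (k : I) :
    ((𝒳.outerCenter S).comap (𝒳.subι k)).IsDilatation (𝒳.inner S k).hom := by
  rw [comap_deformationCenter]
  exact isDilatation_deformationSpace

lemma exists_innerHom (k : I) :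
    ∃ F : (Over.map (𝒳.subι k)).obj (𝒳.inner S k) ⟶ 𝒳.outer S, ∀ f, f = F :=
  (𝒳.isDilatation_outer S).exists_hom
    (MultiCenter.isAdmissible_comap_iff.mp (𝒳.isDilatation_inner S k).isAdmissible)

variable {𝒳 S} {k : I} (F : (Over.map (𝒳.subι k)).obj (𝒳.inner S k) ⟶ 𝒳.outer S)

lemma innerHom_w : F.left ≫ (𝒳.outer S).hom = (𝒳.inner S k).hom ≫ 𝒳.subι k := Over.w F

lemma isClosedImmersion_innerHom : IsClosedImmersion F.left :=
  MultiCenter.isClosedImmersion_of_comap (𝒳.isDilatation_outer S) (𝒳.isDilatation_inner S k)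
    (innerHom_w F)

/-- The inner space at `k'` maps to the one at `k` over `X_{k'} ⊆ X_k` by the universal property,
and uniqueness makes `F'` factor through `F`. -/
lemma ker_innerHom_mono {k' : I} (h : k ≤ k')
    (F' : (Over.map (𝒳.subι k')).obj (𝒳.inner S k') ⟶ 𝒳.outer S) : F.left.ker ≤ F'.left.ker := by
  have e : inclusion (𝒳.monotone h) ≫ 𝒳.subι k = 𝒳.subι k' := inclusion_subschemeι _
  have hF' := MultiCenter.isAdmissible_comap_iff.mp (𝒳.isDilatation_inner S k').isAdmissible
  obtain ⟨g, hg⟩ := (𝒳.isDilatation_inner S k).exists_lift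
    (f := (𝒳.inner S k').hom ≫ inclusion (𝒳.monotone h)) (MultiCenter.isAdmissible_comap_iff.mpr
      (by rwa [Category.assoc, e]))
  have hgF : g ≫ F.left = F'.left := by
    refine (𝒳.isDilatation_outer S).hom_ext ?_ ?_
    · rw [Category.assoc, innerHom_w, innerHom_w, reassoc_of% hg, e]
    · rw [Category.assoc, innerHom_w, reassoc_of% hg, e]
      exact hF'.isCartier
  rw [← hgF]
  exact Hom.le_ker_comp g F.left

/-- The center at the least `s ∈ S` is contained in `X_k`, and its divisor is the sum of all `D_s`,
`s ∈ S`. Dividing by this divisor leaves sections vanishing on the inner space. For empty `S` there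
is nothing to divide by. -/
lemma comap_Z_le (hk : ∀ s ∈ S, k ≤ s) :
    (𝒳.Z k).comap (𝒳.outer S).hom ≤ (∏ s ∈ S, 𝒳.D s).comap (𝒳.outer S).hom * F.left.ker := by
  obtain rfl | hS := S.eq_empty_or_nonempty
  · have := Hom.le_ker_comp (𝒳.inner ∅ k).hom (𝒳.subι k)
    rw [ker_subschemeι, ← innerHom_w F, ← map_ker, le_map_iff_comap_le] at this
    simpa using this
  · have := MultiCenter.comap_ker_le_mul_ker (𝒳.isDilatation_outer S) (𝒳.isDilatation_inner S k)
      (innerHom_w F) (j := ⟨S.min' hS, S.min'_mem hS⟩)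
      (by rw [ker_subschemeι]; exact 𝒳.monotone (hk _ (S.min'_mem hS)))
    rw [ker_subschemeι, deformationCenter_divisor, prod_univ_filter_le S 𝒳.D,
      Finset.filter_true_of_mem fun s hs ↦ S.min'_le s hs] at this
    exact this

lemma PanelizationAssumption.prod_ideal_inf (hS : 𝒳.PanelizationAssumption S)
    (hSK : ∀ k ∉ S, ∀ s ∈ S, k < s) (hk : k ∉ S) (U : X.affineOpens) (θ : I → ℕ) :
    ∀ s' ∈ S, θ s' ≠ 0 → (∀ s ∈ S, θ s ≠ 0 → s' ≤ s) →
      (∏ s ∈ S, (𝒳.Z s).ideal U ^ θ s) ⊓ (𝒳.Z k).ideal U =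
        (∏ s ∈ S with s' < s, (𝒳.Z s).ideal U ^ θ s) * (𝒳.Z s').ideal U ^ (θ s' - 1) *
          (𝒳.Z k).ideal U := by
  intro s' hs' hθ h
  have := (hS k hk ⟨s', hs', hSK k hk s' hs'⟩).1 θ s' hs' (hSK k hk s' hs') hθ
    fun s hs _ ↦ h s hs
  rw [Finset.filter_true_of_mem (hSK k hk)] at this
  simpa only [ideal_inf, ideal_mul, ideal_prod, ideal_pow, Pi.inf_apply, Pi.mul_apply,
    Pi.pow_apply] using congr(($this).ideal U)

lemma PanelizationAssumption.iSup_ideal_inf (hS : 𝒳.PanelizationAssumption S)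
    (hSK : ∀ k ∉ S, ∀ s ∈ S, k < s) (hk : k ∉ S) {U : X.affineOpens} {d : I → Γ(X, U)}
    (hd : ∀ i, (𝒳.D i).ideal U = Ideal.span {d i}) (E : Type) (θ γ : E → I → ℕ) :
    (⨆ e, (∏ s ∈ S, Ideal.span {d s} ^ γ e s) * ∏ s ∈ S, (𝒳.Z s).ideal U ^ θ e s) ⊓
        (𝒳.Z k).ideal U =
      ⨆ e, (∏ s ∈ S, Ideal.span {d s} ^ γ e s) *
        ((∏ s ∈ S, (𝒳.Z s).ideal U ^ θ e s) ⊓ (𝒳.Z k).ideal U) := by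
  -- For empty `S` the assumption gives nothing, but all products are the unit ideal and the
  -- identity is trivial.
  obtain rfl | ⟨s, hs⟩ := S.eq_empty_or_nonempty
  · cases isEmpty_or_nonempty E
    · simp [iSup_of_empty]
    · simp [ciSup_const]
  · have := (hS k hk ⟨s, hs, hSK k hk s hs⟩).2 E θ γ
    rw [Finset.filter_true_of_mem (hSK k hk)] at this
    simpa only [ideal_inf, ideal_mul, ideal_prod, ideal_pow, ideal_iSup, iSup_apply, Pi.inf_apply,
      Pi.mul_apply, Pi.pow_apply, hd] using congr(($this).ideal U)

/-- The restriction of `x` to `X_k` dies in the inner space, hence is torsion for products of the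
`d_s`. These are regular on `X_k` by the Cartier hypothesis, so the restriction is already zero. -/
lemma mem_Z_of_mem_ker (h𝒳 : 𝒳.IsCartier) {U : X.affineOpens} {d : I → Γ(X, U)}
    (hd : ∀ i, (𝒳.D i).ideal U = Ideal.span {d i}) {x : Γ(X, U)}
    (hx : (𝒳.outer S).hom.app U x ∈ RingHom.ker (F.left.app ((𝒳.outer S).hom ⁻¹ᵁ U.1)).hom) :
    x ∈ (𝒳.Z k).ideal U := by
  have hπ := (𝒳.isDilatation_inner S k).isDilatation_comap_app U
    (fun s : S ↦ ∏ j : S with s ≤ j, d j) fun s ↦ by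
      simp [ideal_prod, hd, Ideal.prod_span_singleton]
  rw [MultiCenter.mem_ker_app_iff (innerHom_w F)] at hx
  have e := congr($(MultiCenter.app_comp_appLE (innerHom_w F) U.1
    (MultiCenter.preimage_eq (innerHom_w F) U.1).le) x)
  obtain ⟨t, ht, h⟩ := hπ.torsion ((𝒳.subι k).app U.1 x) (e.symm.trans hx)
  have : t ∈ nonZeroDivisors Γ(𝒳.sub k, 𝒳.subι k ⁻¹ᵁ U.1) := by
    refine closure_range_map_mem_nonZeroDivisors (ψ := RingHom.id _) (fun s ↦ ?_) ht
    rw [RingHom.id_apply, map_prod]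
    refine prod_mem fun j _ ↦ ?_
    exact (h𝒳 k j).app_mem_nonZeroDivisors (hd j)
  rw [← ker_subschemeι (𝒳.Z k), Hom.ker_apply, RingHom.mem_ker]
  exact (mul_left_mem_nonZeroDivisors_eq_zero_iff this).mp h

variable [Fintype I]

variable (𝒳) in
/-- The multi-center of `𝒳.space`. -/
noncomputable abbrev center : X.MultiCenter I :=
  deformationCenter 𝒳.Z 𝒳.D 𝒳.isLocallyPrincipal

/-- The hard half of the comparison: what the second dilatation demands of the inner spaces holds on
every `T` admissible for the whole datum. Locally it is `dvd_of_forall_mem`, with `mem_Z_of_mem_ker`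
supplying numerators in `Z_k`. -/
lemma comap_ker_innerHom_le (h𝒳 : 𝒳.IsCartier) (hSK : ∀ k ∉ S, ∀ s ∈ S, k < s)
    (hS : 𝒳.PanelizationAssumption S) (hk : k ∉ S) {T : Scheme.{u}} (g : T ⟶ (𝒳.outer S).left)
    (hg : 𝒳.center.IsAdmissible (g ≫ (𝒳.outer S).hom)) :
    F.left.ker.comap g ≤ ∏ j ∈ Sᶜ with k ≤ j, (𝒳.D j).comap (g ≫ (𝒳.outer S).hom) := by
  have := (𝒳.isDilatation_outer S).isAffineHom
  have := isClosedImmersion_innerHom F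
  refine le_of_forall_exists fun t ↦ ?_
  obtain ⟨U, htU, -, d, hd⟩ := exists_forall_eq_span 𝒳.D 𝒳.isLocallyPrincipal
    (show (g ≫ (𝒳.outer S).hom) t ∈ (⊤ : X.Opens) from trivial)
  obtain ⟨V, htV, hV⟩ := exists_affineOpens_le (show t ∈ (g ≫ (𝒳.outer S).hom) ⁻¹ᵁ U.1 from htU)
  let U' : (𝒳.outer S).left.affineOpens := ⟨(𝒳.outer S).hom ⁻¹ᵁ U.1, U.2.preimage _⟩
  have e (y : Γ(X, U)) : g.appLE U' V.1 hV ((𝒳.outer S).hom.app U y) =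
      (g ≫ (𝒳.outer S).hom).appLE U.1 V.1 hV y :=
    congr($((Scheme.Hom.comp_appLE g (𝒳.outer S).hom U.1 V.1 hV).symm) y)
  have hdil := (𝒳.isDilatation_outer S).isDilatation_app U
    (fun s : S ↦ ∏ j : S with s ≤ j, d j) fun s ↦ by
      simp [ideal_prod, hd, Ideal.prod_span_singleton]
  obtain ⟨hg₁, hg₂⟩ := isAdmissible_deformationCenter_iff.mp hg
  refine ⟨V, htV, ?_⟩
  rw [ideal_comap F.left.ker g U' V hV, Ideal.map_le_iff_le_comap, ideal_prod,
    Finset.prod_congr rfl fun j _ ↦ ideal_comap_eq_span (𝒳.D j) _ hV (hd j),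
    Ideal.prod_span_singleton]
  intro b hb
  rw [Hom.ker_apply] at hb
  rw [Ideal.mem_comap, Ideal.mem_span_singleton, ← map_prod, ← e]
  refine dvd_of_forall_mem hdil hk hSK (hS.prod_ideal_inf hSK hk U)
    (hS.iSup_ideal_inf hSK hk hd) (fun i m hm ↦ ?_) (fun i ↦ ?_) fun N x hx ↦ ?_
  · have := hg₂ i V
    rw [ideal_comap _ _ U V hV, Ideal.map_le_iff_le_comap, ideal_prod,
      Finset.prod_congr rfl fun j _ ↦ ideal_comap_eq_span (𝒳.D j) _ hV (hd j),
      Ideal.prod_span_singleton] at this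
    have := this hm
    rw [Ideal.mem_comap, Ideal.mem_span_singleton, ← map_prod, ← e] at this
    exact this.trans (e m).symm.dvd
  · have := (hg₁ i).appLE_mem_nonZeroDivisors hV (hd i)
    rw [← e] at this
    exact this
  · refine mem_Z_of_mem_ker F h𝒳 hd ?_
    exact hx ▸ Ideal.mul_mem_left _ _ hb

end DeformationDatum

end AlgebraicGeometry.Scheme

/-! ### The panelization isomorphism. -/

namespace AlgebraicGeometry.Scheme.DeformationDatum

open IdealSheafData

variable {X : Scheme.{u}} {I : Type v} [LinearOrder I] {𝒳 : X.DeformationDatum I} {S : Finset I}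

lemma innerSub_eq_inner {k : I} (hk : ∀ s ∈ S, k ≤ s) : 𝒳.innerSub S k hk = 𝒳.inner S k := by
  simp only [innerSub, inner, ker_inclusion]

lemma isCartier_comap_outer {s : I} (hs : s ∈ S) :
    ((𝒳.D s).comap (𝒳.outer S).hom).IsCartier :=
  (isAdmissible_deformationCenter_iff.mp (𝒳.isDilatation_outer S).isAdmissible).1 ⟨s, hs⟩

lemma comap_outer_le {s : I} (hs : s ∈ S) :
    (𝒳.Z s).comap (𝒳.outer S).hom ≤ ∏ j ∈ S with s ≤ j, (𝒳.D j).comap (𝒳.outer S).hom := by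
  rw [← prod_univ_filter_le S (fun j ↦ (𝒳.D j).comap (𝒳.outer S).hom) ⟨s, hs⟩]
  exact (isAdmissible_deformationCenter_iff.mp (𝒳.isDilatation_outer S).isAdmissible).2 ⟨s, hs⟩

variable [Fintype I]

lemma isDilatation_space : 𝒳.center.IsDilatation 𝒳.space.hom :=
  isDilatation_deformationSpace

lemma prod_univ_filter_le_of_mem {R : Type*} [CommMonoid R] (hSK : ∀ k ∉ S, ∀ s ∈ S, k < s)
    {s : I} (hs : s ∈ S) (f : I → R) : ∏ j with s ≤ j, f j = ∏ j ∈ S with s ≤ j, f j := by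
  refine Finset.prod_congr (Finset.ext fun j ↦ ?_) fun _ _ ↦ rfl
  simp only [Finset.mem_filter, Finset.mem_univ, true_and, iff_and_self]
  exact fun h ↦ by_contra fun hj ↦ (hSK j hj s hs).not_ge h

lemma prod_univ_filter_le_of_notMem {R : Type*} [CommMonoid R] (hSK : ∀ k ∉ S, ∀ s ∈ S, k < s)
    {k : I} (hk : k ∉ S) (f : I → R) :
    ∏ j with k ≤ j, f j = (∏ s ∈ S, f s) * ∏ j ∈ Sᶜ with k ≤ j, f j := by
  rw [Finset.prod_filter, Finset.prod_filter, ← Finset.prod_mul_prod_compl S]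
  congr 1
  exact Finset.prod_congr rfl fun s hs ↦ if_pos (hSK k hk s hs).le

variable (F : ∀ k : ↥Sᶜ, (Over.map (𝒳.subι k)).obj (𝒳.inner S k) ⟶ 𝒳.outer S)

/-- The multi-center on `𝒳.outer S` of the second dilatation in `𝒳.panel S`. -/
noncomputable abbrev panelCenter : (𝒳.outer S).left.MultiCenter ↥Sᶜ :=
  deformationCenter (fun k ↦ (F k).left.ker) (fun k ↦ (𝒳.D k).comap (𝒳.outer S).hom)
    (fun k ↦ (𝒳.isLocallyPrincipal k).comap _)

/-- The structure morphism of `𝒳.panel S` over `𝒳.outer S`. -/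
noncomputable abbrev panelHom :
    (𝒳.panel S fun k ↦ (F k).left.ker).left ⟶ (𝒳.outer S).left :=
  (deformationSpace (fun k ↦ (F k).left.ker) (fun k ↦ (𝒳.D k).comap (𝒳.outer S).hom)
    (fun k ↦ (𝒳.isLocallyPrincipal k).comap _)).hom

lemma isDilatation_panelHom : (panelCenter F).IsDilatation (panelHom F) :=
  isDilatation_deformationSpace

lemma panel_hom_eq :
    (𝒳.panel S fun k ↦ (F k).left.ker).hom = panelHom F ≫ (𝒳.outer S).hom := rfl

lemma isCartier_comap_panel (i : I) :
    ((𝒳.D i).comap (𝒳.panel S fun k ↦ (F k).left.ker).hom).IsCartier := by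
  rw [panel_hom_eq, comap_comp]
  by_cases hi : i ∈ S
  · exact (isDilatation_panelHom F).isCartier_comap_of_isCartier (isCartier_comap_outer hi)
  · exact (isAdmissible_deformationCenter_iff.mp (isDilatation_panelHom F).isAdmissible).1
      ⟨i, Finset.mem_compl.mpr hi⟩

/-- For `k ∉ S` the required divisor splits: the part in `S` comes from `comap_Z_le`, the rest from
the center at `k` of the second dilatation. -/
lemma isAdmissible_panel (hSK : ∀ k ∉ S, ∀ s ∈ S, k < s) :
    𝒳.center.IsAdmissible (𝒳.panel S fun k ↦ (F k).left.ker).hom := by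
  refine isAdmissible_deformationCenter_iff.mpr ⟨isCartier_comap_panel F, fun i ↦ ?_⟩
  simp only [panel_hom_eq, comap_comp]
  by_cases hi : i ∈ S
  · rw [prod_univ_filter_le_of_mem hSK hi, ← comap_prod]
    exact comap_mono _ (comap_outer_le hi)
  · let k : ↥Sᶜ := ⟨i, Finset.mem_compl.mpr hi⟩
    have hp := (isAdmissible_deformationCenter_iff.mp (isDilatation_panelHom F).isAdmissible).2 k
    rw [prod_univ_filter_le Sᶜ
      (fun j ↦ ((𝒳.D j).comap (𝒳.outer S).hom).comap (panelHom F))] at hp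
    have h := comap_mono (panelHom F) (comap_Z_le (F k) fun s hs ↦ (hSK i hi s hs).le)
    beta_reduce at h
    rw [comap_mul, comap_prod, comap_prod] at h
    rw [prod_univ_filter_le_of_notMem hSK hi]
    exact h.trans fun U ↦ Ideal.mul_mono_right (hp U)

/-- Uniqueness is used twice, first for the composites to `𝔻_S` over `X`, then for their lifts to
the second dilatation. -/
lemma panel_hom_ext {T : Over X} {f f' : T ⟶ 𝒳.panel S fun k ↦ (F k).left.ker}
    (h : ∀ i, ((𝒳.D i).comap T.hom).IsCartier) : f = f' := by
  have hf : (f.left ≫ panelHom F) ≫ (𝒳.outer S).hom = T.hom :=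
    (Category.assoc _ _ _).trans (Over.w f)
  have hf' : (f'.left ≫ panelHom F) ≫ (𝒳.outer S).hom = T.hom :=
    (Category.assoc _ _ _).trans (Over.w f')
  have e : f.left ≫ panelHom F = f'.left ≫ panelHom F :=
    congr(($(deformationSpace_hom_ext (g := Over.homMk _ hf) (g' := Over.homMk _ hf')
      fun s ↦ h s)).left)
  ext
  refine (isDilatation_panelHom F).hom_ext e fun k ↦ ?_
  rw [deformationCenter_divisor, comap_prod]
  refine .prod _ _ fun j _ ↦ ?_
  rw [← comap_comp, hf]
  exact h j

lemma exists_hom_panel (h𝒳 : 𝒳.IsCartier) (hSK : ∀ k ∉ S, ∀ s ∈ S, k < s)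
    (hS : 𝒳.PanelizationAssumption S) {T : Over X} (hT : 𝒳.center.IsAdmissible T.hom) :
    Nonempty (T ⟶ 𝒳.panel S fun k ↦ (F k).left.ker) := by
  obtain ⟨h₁, h₂⟩ := isAdmissible_deformationCenter_iff.mp hT
  have hT' : (𝒳.outerCenter S).IsAdmissible T.hom := by
    refine isAdmissible_deformationCenter_iff.mpr ⟨fun s ↦ h₁ s, fun s ↦ ?_⟩
    rw [prod_univ_filter_le S fun j ↦ (𝒳.D j).comap T.hom, ← prod_univ_filter_le_of_mem hSK s.2]
    exact h₂ s
  obtain ⟨g, hg⟩ := (𝒳.isDilatation_outer S).exists_lift hT'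
  have hg' : (panelCenter F).IsAdmissible g := by
    refine isAdmissible_deformationCenter_iff.mpr ⟨fun k ↦ ?_, fun k ↦ ?_⟩
    · rw [← comap_comp, hg]
      exact h₁ k
    · simp only [← comap_comp]
      rw [prod_univ_filter_le Sᶜ fun j ↦ (𝒳.D j).comap (g ≫ (𝒳.outer S).hom)]
      exact comap_ker_innerHom_le (F k) h𝒳 hSK hS (Finset.mem_compl.mp k.2) g (hg ▸ hT)
  obtain ⟨f, hf⟩ := (isDilatation_panelHom F).exists_lift hg'
  exact ⟨Over.homMk f (by rw [panel_hom_eq, reassoc_of% hf, hg])⟩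

theorem exists_panel_hom_space (h𝒳 : 𝒳.IsCartier) (hSK : ∀ k ∉ S, ∀ s ∈ S, k < s)
    (hS : 𝒳.PanelizationAssumption S) :
    ∃ Θ : 𝒳.panel S (fun k ↦ (F k).left.ker) ⟶ 𝒳.space, (∀ f, f = Θ) ∧ IsIso Θ := by
  obtain ⟨Θ, hΘ⟩ := isDilatation_space.exists_hom (isAdmissible_panel F hSK)
  obtain ⟨Ψ⟩ := exists_hom_panel F h𝒳 hSK hS isDilatation_space.isAdmissible
  exact ⟨Θ, hΘ, Ψ, panel_hom_ext F (isCartier_comap_panel F), deformationSpace_hom_ext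
    (isAdmissible_deformationCenter_iff.mp isDilatation_space.isAdmissible).1⟩

end AlgebraicGeometry.Scheme.DeformationDatum

theorem mainTheorem8 {X : Scheme.{u}} {I : Type v} [LinearOrder I] [Fintype I]
    (𝒳 : X.DeformationDatum I) (h𝒳 : 𝒳.IsCartier)
    (S : Finset I) (hSK : ∀ k ∉ S, ∀ s ∈ S, k < s) (hS : 𝒳.PanelizationAssumption S) :
    ∃ (F : ∀ k : ↥Sᶜ, (Over.map (𝒳.subι k)).obj (𝒳.inner S k) ⟶ 𝒳.outer S)
      (Θ : 𝒳.panel S (fun k ↦ (F k).left.ker) ⟶ 𝒳.space)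
      (G : ∀ k : ↥Sᶜ, (Over.map (𝒳.subι k)).obj (𝒳.innerSub S k
        (fun s hs ↦ (hSK k (Finset.mem_compl.mp k.2) s hs).le)) ⟶ 𝒳.outer S)
      (Θ' : 𝒳.panel S (fun k ↦ (G k).left.ker) ⟶ 𝒳.space),
      -- `Θ(S)` is an isomorphism
      ((∀ k, (∀ f, f = F k) ∧ IsClosedImmersion (F k).left) ∧
        Monotone (fun k ↦ (F k).left.ker) ∧
        (∀ f, f = Θ) ∧ IsIso Θ) ∧
      -- the same with the inner spaces `𝔻((D_s over X_s)_{s ∈ S}, X_k)`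
      ((∀ k, (∀ f, f = G k) ∧ IsClosedImmersion (G k).left) ∧
        Monotone (fun k ↦ (G k).left.ker) ∧
        (∀ f, f = Θ') ∧ IsIso Θ') ∧
      -- the two forms are identified
      (∀ k : ↥Sᶜ, ∃ e : 𝒳.inner S k ≅ 𝒳.innerSub S k
          (fun s hs ↦ (hSK k (Finset.mem_compl.mp k.2) s hs).le),
        (∀ f, f = e.hom) ∧ (Over.map (𝒳.subι k)).map e.hom ≫ G k = F k) ∧
      (∃ e : 𝒳.panel S (fun k ↦ (F k).left.ker) ≅ 𝒳.panel S (fun k ↦ (G k).left.ker),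
        (∀ f, f = e.hom) ∧ e.hom ≫ Θ' = Θ) := by
  -- With the inner spaces of the second form replaced by a variable `J`, their equality with the
  -- first ones can be substituted without transporting morphisms. Both forms then coincide and the
  -- comparison isomorphisms are identities.
  suffices H : ∀ J : ∀ k : ↥Sᶜ, Over (𝒳.sub k), J = (fun k : ↥Sᶜ ↦ 𝒳.inner S k) →
    ∃ (F : ∀ k : ↥Sᶜ, (Over.map (𝒳.subι k)).obj (𝒳.inner S k) ⟶ 𝒳.outer S)
      (Θ : 𝒳.panel S (fun k ↦ (F k).left.ker) ⟶ 𝒳.space)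
      (G : ∀ k : ↥Sᶜ, (Over.map (𝒳.subι k)).obj (J k) ⟶ 𝒳.outer S)
      (Θ' : 𝒳.panel S (fun k ↦ (G k).left.ker) ⟶ 𝒳.space),
      ((∀ k, (∀ f, f = F k) ∧ IsClosedImmersion (F k).left) ∧
        Monotone (fun k ↦ (F k).left.ker) ∧
        (∀ f, f = Θ) ∧ IsIso Θ) ∧
      ((∀ k, (∀ f, f = G k) ∧ IsClosedImmersion (G k).left) ∧
        Monotone (fun k ↦ (G k).left.ker) ∧
        (∀ f, f = Θ') ∧ IsIso Θ') ∧
      (∀ k : ↥Sᶜ, ∃ e : 𝒳.inner S k ≅ J k,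
        (∀ f, f = e.hom) ∧ (Over.map (𝒳.subι k)).map e.hom ≫ G k = F k) ∧
      (∃ e : 𝒳.panel S (fun k ↦ (F k).left.ker) ≅ 𝒳.panel S (fun k ↦ (G k).left.ker),
        (∀ f, f = e.hom) ∧ e.hom ≫ Θ' = Θ) from
    H _ (funext fun k ↦ Scheme.DeformationDatum.innerSub_eq_inner _)
  rintro _ rfl
  choose F hF using fun k : ↥Sᶜ ↦ 𝒳.exists_innerHom S k
  obtain ⟨Θ, hΘ, hΘ'⟩ := Scheme.DeformationDatum.exists_panel_hom_space F h𝒳 hSK hS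
  have hmain : (∀ k, (∀ f, f = F k) ∧ IsClosedImmersion (F k).left) ∧
      Monotone (fun k ↦ (F k).left.ker) ∧ (∀ f, f = Θ) ∧ IsIso Θ :=
    ⟨fun k ↦ ⟨hF k, Scheme.DeformationDatum.isClosedImmersion_innerHom (F k)⟩,
      fun k k' h ↦ Scheme.DeformationDatum.ker_innerHom_mono (F k) h (F k'), hΘ, hΘ'⟩
  refine ⟨F, Θ, F, Θ, hmain, hmain, fun k ↦ ⟨Iso.refl _, fun f ↦ ?_, hF k _⟩,
    Iso.refl _, fun f ↦ ?_, hΘ _⟩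
  · exact Scheme.deformationSpace_hom_ext (Scheme.isAdmissible_deformationCenter_iff.mp
      Scheme.isDilatation_deformationSpace.isAdmissible).1
  · exact Scheme.DeformationDatum.panel_hom_ext F
      (Scheme.DeformationDatum.isCartier_comap_panel F)
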